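/- Let $p$ be an odd prime, let $m,\varsigma\ge 1$ be integers, and let $n=4p^{\varsigma}$. For $\beta\in\mathbb F_{p^m}^{\times}$ and a polynomial $g$ over $\mathbb F_{p^m}$, the ideal $\langle g\rangle$ of $\mathbb F_{p^m}[x]/(x^{n}-\beta)$ is regarded as a $\beta$-constacyclic code of length $n$ over $\mathbb F_{p^m}$ by reading off the coefficients. For a linear code $C$ of length $n$, let $k$ be its dimension and $d(C)$ its Hamming distance ($d(C)=0$ for the zero code); $C$ is AMDS if $d(C)=n-k$. (I) Let $\delta\in\mathbb F_{p^m}$ with $\delta^2=-1$, let $\beta=1$ and $C_{\iota,\jmath,\mu,\ell}=\langle (x-1)^{\iota}(x+1)^{\jmath}(x-\delta)^{\mu}(x+\delta)^{\ell}\rangle$. For $0\le \ell\le\jmath\le\mu\le\iota\le p^{\varsigma}$, the code $C_{\iota,\jmath,\mu,\ell}$ is AMDS if and only if $(\iota,\jmath,\mu,\ell)=(2,0,0,0)$, or $(\iota,\jmath,\mu,\ell)=(1,0,1,0)$, or $\varsigma=1$ and $(\iota,\jmath,\mu,\ell)=(2,0,1,0)$. Moreover $d(C_{2,0,0,0})=2$,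 $d(C_{1,0,1,0})=2$, and, if $\varsigma=1$, $d(C_{2,0,1,0})=3$. (II) With $\delta$, $\beta$ and $C_{\iota,\jmath,\mu,\ell}$ as in (I), for $0\le \ell\le\mu\le\jmath\le\iota\le p^{\varsigma}$ the code $C_{\iota,\jmath,\mu,\ell}$ is AMDS if and only if $(\iota,\jmath,\mu,\ell)$ is $(2,0,0,0)$ or $(1,1,0,0)$. Moreover $d(C_{2,0,0,0})=d(C_{1,1,0,0})=2$. (III) Let $\beta=1$ and $C_{\iota,\jmath,\mu}=\langle (x-1)^{\iota}(x+1)^{\jmath}(x^2+1)^{\mu}\rangle$. For $0\le\mu\le\jmath\le\iota\le p^{\varsigma}$, the code $C_{\iota,\jmath,\mu}$ is AMDS if and only if $(\iota,\jmath,\mu)$ is $(1,1,0)$ or $(2,0,0)$. Moreover $d(C_{1,1,0})=d(C_{2,0,0})=2$. (IV) With $\beta$ and $C_{\iota,\jmath,\mu}$ as in (III), for $0\le\jmath\le\mu\le\iota\le p^{\varsigma}$ the code $C_{\iota,\jmath,\mu}$ is AMDS if and only if $(\iota,\jmath,\mu)=(2,0,0)$, and then $d(C_{2,0,0})=2$.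 (V) Let $\phi\in\mathbb F_{p^m}$ be nonzero, $\beta=\phi^{2p^{\varsigma}}$ and $C_{\iota,\jmath}=\langle (x^2-\phi)^{\iota}(x^2+\phi)^{\jmath}\rangle$. For $0\le\iota,\jmath\le p^{\varsigma}$, the code $C_{\iota,\jmath}$ is AMDS if and only if $(\iota,\jmath)$ is $(1,0)$ or $(0,1)$. Moreover $d(C_{1,0})=d(C_{0,1})=2$. (VI) Let $\gamma,c,e\in\mathbb F_{p^m}$ with $\gamma^2=-2$, $e\ne0$ and $c^2=-e$ (so that $(x^2+\gamma c x+e)(x^2-\gamma c x+e)=x^4+e^2$), $\beta=(-e^2)^{p^{\varsigma}}$ and $C_{\iota,\mu}=\langle (x^2+\gamma c x+e)^{\iota}(x^2-\gamma c x+e)^{\mu}\rangle$. For $0\le\iota,\mu\le p^{\varsigma}$, the code $C_{\iota,\mu}$ is AMDS if and only if $(\iota,\mu)$ is $(1,0)$ or $(0,1)$. Moreover $d(C_{1,0})=d(C_{0,1})=2$. (VII) Let $\psi\in\mathbb F_{p^m}$ be nonzero with $x^4+\psi$ irreducible, and $\beta=(-\psi)^{p^{\varsigma}}$. For $0\le\iota\le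 p^{\varsigma}$, the code $\langle (x^4+\psi)^{\iota}\rangle$ is not AMDS. -/

import Mathlib

namespace Constacyclic

open Polynomial

variable {F : Type*} [Field F]

/-- The polynomial `c₀ + c₁ X + ⋯ + c_{n-1} X^{n-1}` attached to a word `c` of length `n`. -/
noncomputable def wordPoly (n : ℕ) : (Fin n → F) →ₗ[F] F[X] where
  toFun c := ∑ i : Fin n, c i • (X : F[X]) ^ (i : ℕ)
  map_add' c d := by simp [add_smul, Finset.sum_add_distrib]
  map_smul' a c := by simp [mul_smul, Finset.smul_sum]

/-- The class of the polynomial of a word in `F[X] / (X^n - β)`. -/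
noncomputable def wordClass (n : ℕ) (β : F) :
    (Fin n → F) →ₗ[F] F[X] ⧸ Ideal.span {(X ^ n - C β : F[X])} :=
  (Ideal.Quotient.mkₐ F (Ideal.span {(X ^ n - C β : F[X])})).toLinearMap ∘ₗ wordPoly n

/-- The code of length `n` in `F^n` which corresponds to the ideal `⟨g⟩` of `F[X] / (X^n - β)`. -/
noncomputable def code (n : ℕ) (β : F) (g : F[X]) : Submodule F (Fin n → F) :=
  ((Ideal.span {Ideal.Quotient.mk (Ideal.span {(X ^ n - C β : F[X])}) g}).restrictScalars F).comap
    (wordClass n β)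

/-- The `β`-constacyclic shift `(c₀, …, c_{n-1}) ↦ (β c_{n-1}, c₀, …, c_{n-2})`; here `i - 1` is
taken in `Fin n`, so that `0 - 1` is the last index. -/
def shift (n : ℕ) [NeZero n] (β : F) (c : Fin n → F) : Fin n → F :=
  fun i => if i = 0 then β * c (i - 1) else c (i - 1)

/-- A linear code is `β`-constacyclic if it is mapped onto itself by the `β`-constacyclic shift. -/
def IsConstacyclic {n : ℕ} [NeZero n] (β : F) (K : Submodule F (Fin n → F)) : Prop :=
  shift n β '' (K : Set (Fin n → F)) = K

open Classical in
/-- The Hamming distance of a code: the least distance of two different codewords (and `0` if there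
are no two different codewords, that is, for the zero code). -/
noncomputable def minDist {n : ℕ} (K : Submodule F (Fin n → F)) : ℕ :=
  sInf {d : ℕ | ∃ x ∈ K, ∃ y ∈ K, x ≠ y ∧ hammingDist x y = d}

/-- A linear `[n, k, d]` code is AMDS if `d = n - k`. -/
def IsAMDS {n : ℕ} (K : Submodule F (Fin n → F)) : Prop :=
  minDist K + Module.finrank F K = n

/-- Multiplication by the class of `X` is the shift. -/
theorem wordClass_shift (n : ℕ) [NeZero n] (β : F) (c : Fin n → F) :
    wordClass n β (shift n β c) =
      Ideal.Quotient.mk (Ideal.span {(X ^ n - C β : F[X])}) X * wordClass n β c := by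
  obtain ⟨k, rfl⟩ := Nat.exists_eq_succ_of_ne_zero (NeZero.ne n)
  have h : (Ideal.Quotient.mk (Ideal.span {(X ^ (k + 1) - C β : F[X])})) (X * wordPoly (k + 1) c)
      = (Ideal.Quotient.mk (Ideal.span {(X ^ (k + 1) - C β : F[X])}))
        (wordPoly (k + 1) (shift (k + 1) β c)) := by
    rw [Ideal.Quotient.mk_eq_mk_iff_sub_mem, Ideal.mem_span_singleton]
    refine ⟨C (c (Fin.last k)), ?_⟩
    have h0 : shift (k + 1) β c 0 = β * c (Fin.last k) := by
      have : (0 : Fin (k + 1)) - 1 = Fin.last k := by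
        rw [sub_eq_iff_eq_add]; simp
      simp [shift, this]
    have h1 : ∀ i : Fin k, shift (k + 1) β c i.succ = c i.castSucc := by
      intro i
      have : i.succ - 1 = i.castSucc := by
        rw [sub_eq_iff_eq_add]; simp
      simp [shift, this]
    simp only [wordPoly, LinearMap.coe_mk, AddHom.coe_mk]
    rw [Fin.sum_univ_castSucc, Fin.sum_univ_succ (fun i => shift (k + 1) β c i • X ^ (i : ℕ))]
    simp only [h0, h1, smul_eq_C_mul, Finset.mul_sum, mul_add, Fin.val_succ, Fin.val_castSucc,
      Fin.val_last, Fin.val_zero, C_mul]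
    have h2 : ∀ i : Fin k, (X : F[X]) * (C (c i.castSucc) * X ^ (i : ℕ))
        = C (c i.castSucc) * X ^ ((i : ℕ) + 1) := fun i => by ring
    simp only [h2]
    ring
  simp only [wordClass, LinearMap.comp_apply, AlgHom.toLinearMap_apply, Ideal.Quotient.mkₐ_eq_mk]
  rw [← map_mul]
  exact h.symm

/-- For a unit `β`, the codes `code n β g` are `β`-constacyclic. -/
theorem code_isConstacyclic (n : ℕ) [NeZero n] (β : F) (hβ : β ≠ 0) (g : F[X]) :
    IsConstacyclic β (code n β g) := by
  have hX : Ideal.Quotient.mk (Ideal.span {(X ^ n - C β : F[X])}) (C β⁻¹ * X ^ (n - 1)) *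
      Ideal.Quotient.mk (Ideal.span {(X ^ n - C β : F[X])}) X = 1 := by
    rw [← map_mul, ← map_one (Ideal.Quotient.mk _), Ideal.Quotient.mk_eq_mk_iff_sub_mem,
      Ideal.mem_span_singleton]
    refine ⟨C β⁻¹, ?_⟩
    have : (X : F[X]) ^ n = X ^ (n - 1) * X := (pow_sub_one_mul (NeZero.ne n) X).symm
    have h2 : (C β * C β⁻¹ : F[X]) = 1 := by rw [← C_mul, mul_inv_cancel₀ hβ, C_1]
    rw [this]
    linear_combination h2
  have hmem : ∀ c, shift n β c ∈ code n β g ↔ c ∈ code n β g := by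
    intro c
    simp only [code, Submodule.mem_comap, Submodule.restrictScalars_mem, wordClass_shift]
    refine ⟨fun h => ?_, fun h => Ideal.mul_mem_left _ _ h⟩
    have := Ideal.mul_mem_left _
      (Ideal.Quotient.mk (Ideal.span {(X ^ n - C β : F[X])}) (C β⁻¹ * X ^ (n - 1))) h
    rwa [← mul_assoc, hX, one_mul] at this
  apply Set.Subset.antisymm
  · rintro _ ⟨c, hc, rfl⟩
    exact (hmem c).2 hc
  · intro d hd
    have hs : shift n β (fun i => if i + 1 = 0 then β⁻¹ * d (i + 1) else d (i + 1)) = d := by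
      funext i
      by_cases hi : i = 0
      · subst hi
        simp [shift, hβ]
      · simp [shift, hi]
    refine ⟨_, (hmem _).1 ?_, hs⟩
    rw [hs]
    exact hd

/-- `⟨(x - 1)^ι (x + 1)^j (x - δ)^μ (x + δ)^ℓ⟩`, of length `4p^ς`, with `β = 1`. -/
noncomputable def linearCode (p ς : ℕ) (δ : F) (ι j μ ℓ : ℕ) :
    Submodule F (Fin (4 * p ^ ς) → F) :=
  code (4 * p ^ ς) 1 ((X - 1) ^ ι * (X + 1) ^ j * (X - C δ) ^ μ * (X + C δ) ^ ℓ)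

variable (F) in
/-- `⟨(x - 1)^ι (x + 1)^j (x² + 1)^μ⟩`, of length `4p^ς`, with `β = 1`. -/
noncomputable def mixedCode (p ς : ℕ) (ι j μ : ℕ) : Submodule F (Fin (4 * p ^ ς) → F) :=
  code (4 * p ^ ς) 1 ((X - 1) ^ ι * (X + 1) ^ j * (X ^ 2 + 1) ^ μ)

/-- `⟨(x² - φ)^ι (x² + φ)^j⟩`, of length `4p^ς`, with `β = φ^(2p^ς)`, so that in characteristic `p`
one has `x^(4p^ς) - β = ((x² - φ)(x² + φ))^(p^ς)`. -/
noncomputable def binomialCode (p ς : ℕ) (φ : F) (ι j : ℕ) :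
    Submodule F (Fin (4 * p ^ ς) → F) :=
  code (4 * p ^ ς) (φ ^ (2 * p ^ ς)) ((X ^ 2 - C φ) ^ ι * (X ^ 2 + C φ) ^ j)

/-- `⟨(x² + γcx + e)^ι (x² - γcx + e)^μ⟩`, of length `4p^ς`, with `β = (-e²)^(p^ς)`. If `γ² = -2` and
`c² = -e`, then the product of the two quadratics is `x⁴ + e²`, so that in characteristic `p`
one has `x^(4p^ς) - β = ((x² + γcx + e)(x² - γcx + e))^(p^ς)`. -/
noncomputable def trinomialCode (p ς : ℕ) (γ c e : F) (ι μ : ℕ) :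
    Submodule F (Fin (4 * p ^ ς) → F) :=
  code (4 * p ^ ς) ((-e ^ 2) ^ p ^ ς)
    ((X ^ 2 + C (γ * c) * X + C e) ^ ι * (X ^ 2 - C (γ * c) * X + C e) ^ μ)

/-- `⟨(x⁴ + ψ)^ι⟩`, of length `4p^ς`, with `β = (-ψ)^(p^ς)`. -/
noncomputable def quarticCode (p ς : ℕ) (ψ : F) (ι : ℕ) : Submodule F (Fin (4 * p ^ ς) → F) :=
  code (4 * p ^ ς) ((-ψ) ^ p ^ ς) ((X ^ 4 + C ψ) ^ ι)

end Constacyclic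

namespace Constacyclic

open Polynomial

/-! ### Number of terms of a polynomial -/

section Support

variable {F : Type*} [Field F]

/-! When `g` divides `X ^ n - β`, the code `⟨g⟩` has dimension `n - deg g` (`finrank_code`), so AMDS
means that the distance equals `deg g` (`isAMDS_iff`). The theorem follows by comparing the degree
with upper bounds for the distance.

Reduction modulo `X ^ n - β` folds exponents and never creates terms, so every multiple of `g` that
is nonzero modulo `X ^ n - β` bounds the distance by its number of terms (`minDist_code_le`). Write
`q = p ^ ς` and let `X ^ n - β = (X ^ 4 - b) ^ q`. Sparse multiples come from two sources: `(X ^ 4 -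
b) ^ k` has at most `k + 1` terms, and by Frobenius `P ^ q` has no more terms than `P`. Products of
the two give bounds linear in the exponents; they stay nonzero because some factor of `X ^ 4 - b`
occurs fewer than `q` times (`not_dvd_mul_pow`).

With the lower bound 2 for proper nonzero codes (`two_le_minDist`), integer arithmetic leaves very
few exponent vectors. Arithmetic alone cannot dispose of two extremes: the zero code, and
one-dimensional codes, whose distance is the full length (`minDist_eq_length_of_mul_eq`). The one
delicate survivor has exponent 2 at one fourth root of unity and 1 at another. Its distance drops to
2 if the roots are `1, -1`, or if `ς ≥ 2`; for roots `1, δ` and `ς = 1` it is 3, since a two-term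
codeword would need an exponent gap divisible by both `p` and `4`, but smaller than `4p`. -/

theorem card_support_expand_le (d : ℕ) (P : F[X]) :
    (expand F d P).support.card ≤ P.support.card := by
  have h : expand F d P = ∑ i ∈ P.support, C (P.coeff i) * X ^ (i * d) := by
    conv_lhs => rw [P.as_sum_support_C_mul_X_pow]
    simp [pow_mul, mul_comm _ d]
  rw [h]
  -- For `d = 0` all exponents collide, so in general only an inequality holds.
  calc _ ≤ (P.support.image (· * d)).card := by
        refine Finset.card_le_card fun k hk => ?_
        rw [mem_support_iff, finsetSum_coeff] at hk
        obtain ⟨i, hi, h⟩ := Finset.exists_ne_zero_of_sum_ne_zero hk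
        rw [coeff_C_mul_X_pow] at h
        exact Finset.mem_image.2 ⟨i, hi, by_contra fun hne => h (if_neg (Ne.symm hne))⟩
    _ ≤ _ := Finset.card_image_le

/-- In characteristic `p`, raising to a power of `p` does not increase the number of terms. -/
theorem card_support_pow_char_pow_le (p : ℕ) [ExpChar F p] (k : ℕ) (P : F[X]) :
    (P ^ p ^ k).support.card ≤ P.support.card := by
  -- `P ^ p ^ k` is `P` with Frobenius applied to the coefficients and `X` replaced by `X ^ p ^ k`.
  rw [← map_iterateFrobenius_expand]
  exact (Finset.card_le_card (support_map_subset _ _)).trans (card_support_expand_le _ _)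

/-- The power is a polynomial of degree `k` in `X ^ d`. -/
theorem card_support_X_pow_add_C_pow_le (d : ℕ) (a : F) (k : ℕ) :
    ((X ^ d + C a) ^ k : F[X]).support.card ≤ k + 1 := by
  have h : ((X ^ d + C a) ^ k : F[X]) = expand F d ((X + C a) ^ k) := by simp
  rw [h]
  refine (card_support_expand_le _ _).trans ((card_supp_le_succ_natDegree _).trans ?_)
  simp

theorem card_support_X_pow_sub_C_pow_le (d : ℕ) (a : F) (k : ℕ) :
    ((X ^ d - C a) ^ k : F[X]).support.card ≤ k + 1 := by
  simpa [sub_eq_add_neg] using card_support_X_pow_add_C_pow_le d (-a) k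

theorem card_support_mul_le_of_le {P Q : F[X]} {a b : ℕ} (hP : P.support.card ≤ a)
    (hQ : Q.support.card ≤ b) : (P * Q).support.card ≤ a * b :=
  card_support_mul_le.trans (Nat.mul_le_mul hP hQ)

theorem card_support_le_of_natDegree_le {P : F[X]} {a : ℕ} (hP : P.natDegree ≤ a) :
    P.support.card ≤ a + 1 :=
  (card_supp_le_succ_natDegree _).trans (Nat.succ_le_succ hP)

end Support

/-! ### Words and polynomials -/

section Words

variable {F : Type*} [Field F] {n : ℕ} {β : F} {g f : F[X]}

theorem coeff_wordPoly (c : Fin n → F) (i : Fin n) : (wordPoly n c).coeff i = c i := by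
  simp only [wordPoly, LinearMap.coe_mk, AddHom.coe_mk, finsetSum_coeff, coeff_smul, coeff_X_pow,
    smul_eq_mul, mul_ite, mul_one, mul_zero, Fin.val_inj]
  simp

theorem coeff_wordPoly_of_le (c : Fin n → F) {k : ℕ} (hk : n ≤ k) : (wordPoly n c).coeff k = 0 := by
  simp only [wordPoly, LinearMap.coe_mk, AddHom.coe_mk, finsetSum_coeff, coeff_smul, coeff_X_pow,
    smul_eq_mul, mul_ite, mul_one, mul_zero]
  exact Finset.sum_eq_zero fun i _ => if_neg (by have := i.2; omega)

theorem wordPoly_eq_zero {c : Fin n → F} : wordPoly n c = 0 ↔ c = 0 := by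
  refine ⟨fun h => funext fun i => ?_, fun h => by rw [h, map_zero]⟩
  rw [← coeff_wordPoly c i, h, coeff_zero, Pi.zero_apply]

theorem degree_wordPoly_lt (c : Fin n → F) : (wordPoly n c).degree < n :=
  (degree_lt_iff_coeff_zero _ _).2 fun _ hk => coeff_wordPoly_of_le c hk

open Classical in
theorem card_support_wordPoly (c : Fin n → F) :
    (wordPoly n c).support.card = hammingNorm c := by
  have : (wordPoly n c).support =
      (Finset.univ.filter fun i => c i ≠ 0).map Fin.valEmbedding := by
    ext k
    simp only [mem_support_iff, Finset.mem_map, Finset.mem_filter, Finset.mem_univ, true_and,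
      Fin.valEmbedding_apply]
    refine ⟨fun h => ?_, ?_⟩
    · have hk : k < n := by
        by_contra hk
        exact h (coeff_wordPoly_of_le c (not_lt.1 hk))
      exact ⟨⟨k, hk⟩, by rwa [← coeff_wordPoly c], rfl⟩
    · rintro ⟨i, hi, rfl⟩
      rwa [coeff_wordPoly]
  rw [this, Finset.card_map, hammingNorm]

theorem wordPoly_single (i : Fin n) (a : F) : wordPoly n (Pi.single i a) = C a * X ^ (i : ℕ) := by
  ext k
  rw [coeff_C_mul_X_pow]
  by_cases hk : k < n
  · have := coeff_wordPoly (Pi.single i a) ⟨k, hk⟩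
    simp only at this
    rw [this, Pi.single_apply]
    simp [Fin.ext_iff]
  · rw [coeff_wordPoly_of_le _ (not_lt.1 hk), if_neg]
    have := i.2
    omega

theorem wordClass_eq (c : Fin n → F) :
    wordClass n β c = Ideal.Quotient.mk (Ideal.span {(X ^ n - C β : F[X])}) (wordPoly n c) := rfl

/-- Since `g` divides the modulus, divisibility by `g` does not depend on the representative of a
class. -/
theorem mem_code_iff (hg : g ∣ X ^ n - C β) {c : Fin n → F} :
    c ∈ code n β g ↔ g ∣ wordPoly n c := by
  simp only [code, Submodule.mem_comap, Submodule.restrictScalars_mem, wordClass_eq]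
  rw [Ideal.mem_span_singleton]
  refine ⟨fun ⟨y, hy⟩ => ?_, fun h => map_dvd _ h⟩
  obtain ⟨h, rfl⟩ := Ideal.Quotient.mk_surjective y
  rw [← map_mul, Ideal.Quotient.mk_eq_mk_iff_sub_mem, Ideal.mem_span_singleton] at hy
  exact (dvd_sub_left (dvd_mul_right g h)).1 (hg.trans hy)

/-- Every class modulo `X ^ n - β` is represented by a word whose weight is at most the number of
terms of a given representative. -/
theorem exists_wordClass_eq (hn : 0 < n) (β : F) (f : F[X]) :
    ∃ c : Fin n → F, wordClass n β c = Ideal.Quotient.mk (Ideal.span {(X ^ n - C β : F[X])}) f ∧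
      (wordPoly n c).support.card ≤ f.support.card := by
  classical
  -- Modulo `X ^ n - β` one has `X ^ k = β ^ (k / n) X ^ (k % n)`; terms may merge or cancel, but
  -- none are created.
  refine ⟨∑ k ∈ f.support, Pi.single ⟨k % n, Nat.mod_lt _ hn⟩ (f.coeff k * β ^ (k / n)), ?_, ?_⟩
  · conv_rhs => rw [f.as_sum_support_C_mul_X_pow]
    rw [map_sum, map_sum]
    refine Finset.sum_congr rfl fun k _ => ?_
    rw [wordClass_eq, wordPoly_single, Ideal.Quotient.mk_eq_mk_iff_sub_mem,
      Ideal.mem_span_singleton]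
    have h1 : (X ^ n - C β : F[X]) ∣ (X ^ n) ^ (k / n) - C β ^ (k / n) := sub_dvd_pow_sub_pow _ _ _
    have h2 : (X : F[X]) ^ k = X ^ (k % n) * (X ^ n) ^ (k / n) := by
      rw [← pow_mul, ← pow_add, Nat.mod_add_div]
    rw [h2, C_mul, C_pow]
    have h3 : C (f.coeff k) * C β ^ (k / n) * X ^ (k % n) -
        C (f.coeff k) * (X ^ (k % n) * (X ^ n) ^ (k / n)) =
        (-(C (f.coeff k) * X ^ (k % n))) * ((X ^ n) ^ (k / n) - C β ^ (k / n)) := by ring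
    exact h3 ▸ h1.mul_left _
  · rw [card_support_wordPoly, hammingNorm, ← Finset.card_map Fin.valEmbedding]
    calc _ ≤ (f.support.image (· % n)).card := by
          refine Finset.card_le_card fun k hk => ?_
          simp only [Finset.mem_map, Finset.mem_filter, Finset.mem_univ, true_and,
            Fin.valEmbedding_apply, Finset.sum_apply] at hk
          obtain ⟨i, hi, rfl⟩ := hk
          obtain ⟨k, hk, h⟩ := Finset.exists_ne_zero_of_sum_ne_zero hi
          refine Finset.mem_image.2 ⟨k, hk, by_contra fun hne => h ?_⟩
          exact Pi.single_eq_of_ne (fun h' => hne (by rw [h'])) _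
      _ ≤ _ := Finset.card_image_le

/-! ### Dimension and distance -/

/-- The code is the kernel of the map from words to `F[X] / (g)`. That map is onto because
remainders modulo `g` have degree below `deg g ≤ n`, and its target has dimension `deg g`. -/
theorem finrank_code (hg : g ∣ X ^ n - C β) (hg0 : g ≠ 0) (hn : g.natDegree ≤ n) :
    Module.finrank F (code n β g) + g.natDegree = n := by
  let T : (Fin n → F) →ₗ[F] AdjoinRoot g := (AdjoinRoot.mkₐ g).toLinearMap ∘ₗ wordPoly n
  have hT : ∀ c, T c = AdjoinRoot.mk g (wordPoly n c) := fun _ => rfl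
  have hker : LinearMap.ker T = code n β g := by
    ext c
    rw [LinearMap.mem_ker, mem_code_iff hg, hT, AdjoinRoot.mk_eq_zero]
  have hrange : LinearMap.range T = ⊤ := by
    rw [LinearMap.range_eq_top]
    intro y
    obtain ⟨f, rfl⟩ := AdjoinRoot.mk_surjective y
    refine ⟨fun i => (f % g).coeff i, ?_⟩
    have : wordPoly n (fun i => (f % g).coeff i) = f % g := by
      ext k
      by_cases hk : k < n
      · exact coeff_wordPoly (fun i : Fin n => (f % g).coeff i) ⟨k, hk⟩
      · rw [coeff_wordPoly_of_le _ (not_lt.1 hk), coeff_eq_zero_of_degree_lt]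
        refine (EuclideanDomain.mod_lt f hg0).trans_le ?_
        rw [degree_eq_natDegree hg0]
        exact_mod_cast hn.trans (not_lt.1 hk)
    rw [hT, this, AdjoinRoot.mk_eq_mk]
    exact ⟨-(f / g), by linear_combination EuclideanDomain.div_add_mod f g⟩
  have h := LinearMap.finrank_range_add_finrank_ker T
  rw [hrange, hker, finrank_top, (AdjoinRoot.powerBasis hg0).finrank, AdjoinRoot.powerBasis_dim,
    Module.finrank_fin_fun] at h
  omega

theorem isAMDS_iff (hg : g ∣ X ^ n - C β) (hg0 : g ≠ 0) (hn : g.natDegree ≤ n) :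
    IsAMDS (code n β g) ↔ minDist (code n β g) = g.natDegree := by
  have := finrank_code hg hg0 hn
  unfold IsAMDS
  omega

theorem minDist_le_of_mem {K : Submodule F (Fin n → F)} {c : Fin n → F} (hc : c ∈ K) (h0 : c ≠ 0) :
    minDist K ≤ (wordPoly n c).support.card := by
  classical
  refine Nat.sInf_le ⟨0, K.zero_mem, c, hc, h0.symm, ?_⟩
  rw [card_support_wordPoly, hammingDist_eq_hammingNorm, neg_zero, zero_add]

/-- The number of terms of any representative of a nonzero codeword bounds the distance. -/
theorem minDist_code_le (hn : 0 < n) (hgf : g ∣ f) (hf : ¬ (X ^ n - C β) ∣ f) :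
    minDist (code n β g) ≤ f.support.card := by
  obtain ⟨c, hc, hle⟩ := exists_wordClass_eq hn β f
  refine (minDist_le_of_mem ?_ ?_).trans hle
  · simp only [code, Submodule.mem_comap, Submodule.restrictScalars_mem, hc]
    exact Ideal.mem_span_singleton.2 (map_dvd _ hgf)
  · rintro rfl
    rw [map_zero, eq_comm, Ideal.Quotient.eq_zero_iff_mem, Ideal.mem_span_singleton] at hc
    exact hf hc

/-- The distance of a nonzero code is the number of terms of the polynomial of a nonzero codeword. -/
theorem exists_minDist_eq (hg : g ∣ X ^ n - C β) (hg0 : g ≠ 0) (hn : g.natDegree < n) :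
    ∃ c : Fin n → F, c ≠ 0 ∧ g ∣ wordPoly n c ∧
      (wordPoly n c).support.card = minDist (code n β g) := by
  classical
  have hne : {d : ℕ | ∃ x ∈ code n β g, ∃ y ∈ code n β g, x ≠ y ∧ hammingDist x y = d}.Nonempty := by
    have h1 : code n β g ≠ ⊥ := by
      intro h
      have := finrank_code hg hg0 hn.le
      rw [h, finrank_bot] at this
      omega
    obtain ⟨c, hc, h0⟩ := Submodule.exists_mem_ne_zero_of_ne_bot h1
    exact ⟨_, c, hc, 0, Submodule.zero_mem _, h0, rfl⟩
  obtain ⟨x, hx, y, hy, hxy, h⟩ := Nat.sInf_mem hne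
  -- By linearity the distance of two codewords is the weight of their difference.
  refine ⟨-x + y, fun h0 => hxy ?_, ?_, ?_⟩
  · rwa [neg_add_eq_zero] at h0
  · exact (mem_code_iff hg).1 (add_mem (neg_mem hx) hy)
  · rw [card_support_wordPoly, ← hammingDist_eq_hammingNorm, h, minDist]

theorem one_le_minDist (hg : g ∣ X ^ n - C β) (hg0 : g ≠ 0) (hn : g.natDegree < n) :
    1 ≤ minDist (code n β g) := by
  obtain ⟨c, h0, -, h⟩ := exists_minDist_eq hg hg0 hn
  rw [← h, Nat.one_le_iff_ne_zero, Ne, card_support_eq_zero, wordPoly_eq_zero]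
  exact h0

theorem isCoprime_X_pow_sub_C (hn : n ≠ 0) (hβ : β ≠ 0) : IsCoprime (X ^ n - C β : F[X]) X := by
  refine ⟨-C β⁻¹, C β⁻¹ * X ^ (n - 1), ?_⟩
  have h1 : (C β⁻¹ * C β : F[X]) = 1 := by rw [← C_mul, inv_mul_cancel₀ hβ, C_1]
  have h2 : (X : F[X]) ^ (n - 1) * X = X ^ n := pow_sub_one_mul hn X
  linear_combination h1 + C β⁻¹ * h2

/-- A codeword of weight one is a monomial `a X ^ k`. As `β ≠ 0`, `g` is coprime to `X`, so `g`
would divide the nonzero constant `a`. -/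
theorem two_le_minDist (hβ : β ≠ 0) (hg : g ∣ X ^ n - C β) (h1 : 1 ≤ g.natDegree)
    (hn : g.natDegree < n) : 2 ≤ minDist (code n β g) := by
  have hg0 : g ≠ 0 := by rintro rfl; simp at h1
  have h := one_le_minDist hg hg0 hn
  by_contra hlt
  obtain ⟨c, h0, hdvd, hc⟩ := exists_minDist_eq hg hg0 hn
  rw [show minDist (code n β g) = 1 by omega, card_support_eq_one] at hc
  obtain ⟨k, a, ha, hc⟩ := hc
  rw [hc] at hdvd
  have hco : IsCoprime g (X ^ k) :=
    ((isCoprime_X_pow_sub_C (by omega) hβ).of_isCoprime_of_dvd_left hg).pow_right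
  have hu := hco.dvd_of_dvd_mul_right hdvd
  have := natDegree_le_of_dvd hu (C_ne_zero.2 ha)
  rw [natDegree_C] at this
  omega

theorem minDist_eq_two (hβ : β ≠ 0) (hg : g ∣ X ^ n - C β) (h1 : 1 ≤ g.natDegree)
    (hn : g.natDegree < n) (hgf : g ∣ f) (hf : ¬ (X ^ n - C β) ∣ f) (h2 : f.support.card ≤ 2) :
    minDist (code n β g) = 2 :=
  le_antisymm ((minDist_code_le (by omega) hgf hf).trans h2) (two_le_minDist hβ hg h1 hn)

/-- A code of dimension one given by `(X ^ n - β) / (X - a)` has no zero coordinates in its nonzero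
words. -/
theorem minDist_eq_length_of_mul_eq {a : F} (hn : 0 < n) (hβ : β ≠ 0)
    (hg : (X - C a) * g = X ^ n - C β) : minDist (code n β g) = n := by
  have hmon : (X ^ n - C β : F[X]).natDegree = n := natDegree_X_pow_sub_C
  have hN : (X ^ n - C β : F[X]) ≠ 0 := by intro h; rw [h, natDegree_zero] at hmon; omega
  have hg0 : g ≠ 0 := by rintro rfl; exact hN (by rw [← hg, mul_zero])
  have hdeg : g.natDegree + 1 = n := by
    rw [← hmon, ← hg, natDegree_mul (X_sub_C_ne_zero a) hg0, natDegree_X_sub_C, add_comm]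
  have ha : a ≠ 0 := by
    rintro rfl
    apply hβ
    have := congrArg (eval 0) hg
    simpa [zero_pow hn.ne'] using this.symm
  have hgN : g ∣ X ^ n - C β := ⟨_, by rw [← hg, mul_comm]⟩
  obtain ⟨c, h0, ⟨k, hk⟩, hc⟩ := exists_minDist_eq hgN hg0 (by omega)
  -- By degree the codeword is a scalar multiple of `g`, so multiplying it by `X - a` gives a
  -- multiple of `X ^ n - β`, whose coefficients strictly between `0` and `n` vanish. Since `a ≠ 0`,
  -- the coefficients of the word then vanish all together or not at all.
  have hrec : ∀ i, i + 1 < n → (wordPoly n c).coeff i = a * (wordPoly n c).coeff (i + 1) := by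
    intro i hi
    have hP0 : wordPoly n c ≠ 0 := fun h => h0 (wordPoly_eq_zero.1 h)
    have hk0 : k ≠ 0 := by rintro rfl; exact hP0 (by rw [hk, mul_zero])
    have hkdeg : k.natDegree = 0 := by
      have h1 := (natDegree_lt_iff_degree_lt hP0).2 (degree_wordPoly_lt c)
      rw [hk, natDegree_mul hg0 hk0] at h1
      omega
    have h1 : (X - C a) * wordPoly n c = C (k.coeff 0) * (X ^ n - C β) := by
      rw [← eq_C_of_natDegree_eq_zero hkdeg, hk, ← hg]; ring
    have h2 := congrArg (fun P => P.coeff (i + 1)) h1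
    simp only [sub_mul, coeff_sub, coeff_X_mul, coeff_C_mul, coeff_X_pow, coeff_C] at h2
    rw [if_neg (by omega), if_neg (by omega)] at h2
    linear_combination h2
  have hiff : ∀ i < n, ((wordPoly n c).coeff i = 0 ↔ (wordPoly n c).coeff 0 = 0) := by
    intro i
    induction i with
    | zero => simp
    | succ i ih =>
      intro hi
      rw [← ih (by omega), hrec i hi]
      simp [ha]
  have hne : (wordPoly n c).coeff 0 ≠ 0 := fun h => h0 <| funext fun i => by
    rw [← coeff_wordPoly c i, (hiff i i.2).2 h, Pi.zero_apply]
  rw [← hc]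
  have : (wordPoly n c).support = Finset.range n := by
    ext i
    rw [mem_support_iff, Finset.mem_range]
    refine ⟨fun h => ?_, fun h h' => hne ((hiff i h).1 h')⟩
    by_contra hi
    exact h (coeff_wordPoly_of_le c (not_lt.1 hi))
  rw [this, Finset.card_range]

/-- The zero code is not AMDS. -/
theorem not_isAMDS_of_natDegree_eq (hn : 0 < n) (hg : g ∣ X ^ n - C β) (hdeg : g.natDegree = n) :
    ¬ IsAMDS (code n β g) := by
  have hg0 : g ≠ 0 := by rintro rfl; rw [natDegree_zero] at hdeg; omega
  rw [isAMDS_iff hg hg0 hdeg.le, hdeg]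
  have hbot : code n β g = ⊥ := by
    have := finrank_code hg hg0 hdeg.le
    exact Submodule.finrank_eq_zero.1 (by omega)
  -- The default value `sInf ∅ = 0`, whereas AMDS would require `n > 0`.
  have : minDist (code n β g) = 0 := by
    rw [minDist, hbot, Nat.sInf_eq_zero]
    right
    ext d
    simp only [Submodule.mem_bot, Set.mem_ofPred_eq, Set.mem_empty_iff_false, iff_false]
    rintro ⟨x, rfl, y, rfl, h, -⟩
    exact h rfl
  omega

/-- If `B ^ q` divides the modulus, then a product of `B ^ k`, `k < q`, and a factor prime to `B` is
nonzero modulo it. -/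
theorem not_dvd_mul_pow {N A B : F[X]} {q k : ℕ} (hN : B ^ q ∣ N) (hco : IsCoprime B A)
    (hB : 0 < B.natDegree) (hk : k < q) : ¬ N ∣ A * B ^ k := by
  intro h
  have hB0 : B ≠ 0 := by rintro rfl; simp at hB
  have h1 : B ^ q ∣ B ^ k := (hco.pow_left).dvd_of_dvd_mul_left (hN.trans h)
  have h2 := natDegree_le_of_dvd h1 (pow_ne_zero _ hB0)
  rw [natDegree_pow, natDegree_pow] at h2
  exact absurd (Nat.le_of_mul_le_mul_right h2 hB) (not_le.2 hk)

end Words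

/-! ### Length `4 p ^ ς` in characteristic `p` -/

section PrimePower

variable {F : Type*} [Field F] {p ς : ℕ}

theorem X_pow_sub_C_eq_pow [Fact p.Prime] [CharP F p] (ς : ℕ) (b : F) :
    (X ^ (4 * p ^ ς) - C (b ^ p ^ ς) : F[X]) = (X ^ 4 - C b) ^ p ^ ς := by
  rw [sub_pow_char_pow, pow_mul, C_pow]

theorem minDist_le_of_isCoprime {n q k w : ℕ} {β : F} {g A B : F[X]} (hn : 0 < n)
    (hN : B ^ q ∣ X ^ n - C β) (hco : IsCoprime B A) (hB : 0 < B.natDegree) (hk : k < q)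
    (hg : g ∣ A * B ^ k) (hw : (A * B ^ k).support.card ≤ w) : minDist (code n β g) ≤ w :=
  (minDist_code_le hn hg (not_dvd_mul_pow hN hco hB hk)).trans hw

/-- Powers of `X ^ 4 - b` below the `p ^ ς`-th are nonzero modulo `X ^ (4 p ^ ς) - b ^ (p ^ ς)`. -/
theorem not_dvd_pow [Fact p.Prime] [CharP F p] {b : F} {k : ℕ} (hk : k < p ^ ς) :
    ¬ (X ^ (4 * p ^ ς) - C (b ^ p ^ ς) : F[X]) ∣ (X ^ 4 - C b) ^ k := by
  have h := not_dvd_mul_pow (A := 1) (X_pow_sub_C_eq_pow ς b).symm.dvd isCoprime_one_right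
    (by rw [natDegree_X_pow_sub_C]; norm_num) hk
  rwa [one_mul] at h

theorem minDist_le_of_dvd_pow [Fact p.Prime] [CharP F p] {b : F} {k : ℕ} {g : F[X]}
    (hk : k < p ^ ς) (hg : g ∣ (X ^ 4 - C b) ^ k) :
    minDist (code (4 * p ^ ς) (b ^ p ^ ς) g) ≤ k + 1 :=
  (minDist_code_le (by omega) hg (not_dvd_pow hk)).trans (card_support_X_pow_sub_C_pow_le 4 b k)

theorem three_le_pow (hp : p.Prime) (hp2 : p ≠ 2) (hς : 1 ≤ ς) : 3 ≤ p ^ ς :=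
  (show 3 ≤ p by have := hp.two_le; omega).trans (Nat.le_self_pow (by omega) p)

/-! ### Two quadratic factors -/

theorem natDegree_pow_mul_pow {A B : F[X]} (hA : A.natDegree = 2) (hB : B.natDegree = 2)
    (i j : ℕ) : (A ^ i * B ^ j).natDegree = 2 * (i + j) := by
  have hA0 : A ≠ 0 := by rintro rfl; simp at hA
  have hB0 : B ≠ 0 := by rintro rfl; simp at hB
  rw [natDegree_mul (pow_ne_zero _ hA0) (pow_ne_zero _ hB0), natDegree_pow, natDegree_pow, hA, hB]
  ring

/-- The word is `A ^ q (X ^ 4 - b) ^ j` with `q = p ^ ς`: at most 3 terms from the Frobenius power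
of a quadratic, times `j + 1`. It contains `B` only `j < q` times, hence is nonzero. -/
theorem minDist_quadratic_le [Fact p.Prime] [CharP F p] {b : F} {A B : F[X]} {i j : ℕ}
    (hA : A.natDegree = 2) (hB : B.natDegree = 2) (hAB : A * B = X ^ 4 - C b)
    (hco : IsCoprime A B) (hi : i ≤ p ^ ς) (hj : j < p ^ ς) :
    minDist (code (4 * p ^ ς) (b ^ p ^ ς) (A ^ i * B ^ j)) ≤ 3 * (j + 1) := by
  have hf : A ^ p ^ ς * (X ^ 4 - C b) ^ j = A ^ (p ^ ς + j) * B ^ j := by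
    rw [← hAB]; ring
  refine minDist_le_of_isCoprime (A := A ^ (p ^ ς + j)) (B := B) (by omega) ?_
    hco.symm.pow_right (by omega) hj
    (mul_dvd_mul (pow_dvd_pow _ (by omega)) dvd_rfl) ?_
  · rw [X_pow_sub_C_eq_pow, ← hAB]
    exact pow_dvd_pow_of_dvd (dvd_mul_left _ _) _
  · rw [← hf]
    exact card_support_mul_le_of_le ((card_support_pow_char_pow_le p ς A).trans
      (card_support_le_of_natDegree_le hA.le)) (card_support_X_pow_sub_C_pow_le 4 b j)

/-- The two-term word is `X ^ 4 - b` itself. -/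
theorem minDist_quadratic_eq_two [Fact p.Prime] [CharP F p] {b : F} {A B : F[X]}
    (hq : 3 ≤ p ^ ς) (hb : b ≠ 0) (hA : A.natDegree = 2) (hAB : A * B = X ^ 4 - C b) :
    minDist (code (4 * p ^ ς) (b ^ p ^ ς) A) = 2 := by
  have hA1 : A ∣ (X ^ 4 - C b) ^ 1 := by rw [pow_one, ← hAB]; exact dvd_mul_right _ _
  refine minDist_eq_two (pow_ne_zero _ hb) ?_ (by omega) (by omega) hA1 (not_dvd_pow (by omega))
    (card_support_X_pow_sub_C_pow_le 4 b 1)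
  rw [X_pow_sub_C_eq_pow]
  exact hA1.trans (pow_dvd_pow _ (by omega))

/-- With `q = p ^ ς`: if both exponents are below `q`, then `2 (i + j) ≤ max i j + 1` forces a
single factor. If exactly one of them is `q` and the other is `j`, then `2 (q + j) ≤ 3 (j + 1)`
contradicts `j < q` and `3 ≤ q`. If both are `q`, the code is zero. -/
theorem isAMDS_quadratic_iff [Fact p.Prime] [CharP F p] {b : F} {A B : F[X]} {i j : ℕ}
    (hq : 3 ≤ p ^ ς) (hb : b ≠ 0) (hA : A.natDegree = 2) (hB : B.natDegree = 2)
    (hAB : A * B = X ^ 4 - C b) (hco : IsCoprime A B) (hi : i ≤ p ^ ς) (hj : j ≤ p ^ ς) :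
    IsAMDS (code (4 * p ^ ς) (b ^ p ^ ς) (A ^ i * B ^ j)) ↔ (i = 1 ∧ j = 0) ∨ (i = 0 ∧ j = 1) := by
  have hBA : B * A = X ^ 4 - C b := by rw [mul_comm, hAB]
  have hdeg := natDegree_pow_mul_pow hA hB i j
  have hg : A ^ i * B ^ j ∣ X ^ (4 * p ^ ς) - C (b ^ p ^ ς) := by
    rw [X_pow_sub_C_eq_pow, ← hAB, mul_pow]
    exact mul_dvd_mul (pow_dvd_pow _ hi) (pow_dvd_pow _ hj)
  have hg0 : A ^ i * B ^ j ≠ 0 := by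
    refine mul_ne_zero (pow_ne_zero _ ?_) (pow_ne_zero _ ?_) <;> rintro rfl <;> simp at hA hB
  rw [isAMDS_iff hg hg0 (by omega), hdeg]
  constructor
  · intro h
    by_cases hmax : i < p ^ ς ∧ j < p ^ ς
    · have hpos := one_le_minDist hg hg0 (by omega)
      have hle := minDist_le_of_dvd_pow (ς := ς) (b := b) (k := max i j) (g := A ^ i * B ^ j)
        (by omega) (by
          rw [← hAB, mul_pow]
          exact mul_dvd_mul (pow_dvd_pow _ (by omega)) (pow_dvd_pow _ (by omega)))
      omega
    · by_cases hj' : j < p ^ ς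
      · have := minDist_quadratic_le hA hB hAB hco hi hj'
        omega
      · by_cases hi' : i < p ^ ς
        · have := minDist_quadratic_le hB hA hBA hco.symm hj hi'
          rw [mul_comm (B ^ j)] at this
          omega
        · refine absurd ((isAMDS_iff hg hg0 (by omega)).2 (h.trans hdeg.symm))
            (not_isAMDS_of_natDegree_eq (by omega) hg (by omega))
  · rintro (⟨rfl, rfl⟩ | ⟨rfl, rfl⟩)
    · simpa using minDist_quadratic_eq_two hq hb hA hAB
    · simpa using minDist_quadratic_eq_two hq hb hB hBA

/-! ### Four linear factors -/

/-- `a₁, a₂, a₃, a₄` are the four different fourth roots of unity. -/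
structure FourthRoots (a₁ a₂ a₃ a₄ : F) : Prop where
  prod_eq : (X - C a₁) * (X - C a₂) * (X - C a₃) * (X - C a₄) = (X ^ 4 - C 1 : F[X])
  ne₁ : a₄ ≠ a₁
  ne₂ : a₄ ≠ a₂
  ne₃ : a₄ ≠ a₃

variable {a₁ a₂ a₃ a₄ : F} {e₁ e₂ e₃ e₄ : ℕ}

theorem natDegree_linear_factors (a₁ a₂ a₃ a₄ : F) (e₁ e₂ e₃ e₄ : ℕ) :
    ((X - C a₁) ^ e₁ * (X - C a₂) ^ e₂ * (X - C a₃) ^ e₃ * (X - C a₄) ^ e₄).natDegree =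
      e₁ + e₂ + e₃ + e₄ := by
  have h : ∀ (a : F) (e : ℕ), (X - C a) ^ e ≠ 0 := fun a e => pow_ne_zero _ (X_sub_C_ne_zero a)
  rw [natDegree_mul (mul_ne_zero (mul_ne_zero (h _ _) (h _ _)) (h _ _)) (h _ _),
    natDegree_mul (mul_ne_zero (h _ _) (h _ _)) (h _ _), natDegree_mul (h _ _) (h _ _)]
  simp only [natDegree_pow, natDegree_X_sub_C, mul_one]

theorem linear_factors_ne_zero (a₁ a₂ a₃ a₄ : F) (e₁ e₂ e₃ e₄ : ℕ) :
    (X - C a₁) ^ e₁ * (X - C a₂) ^ e₂ * (X - C a₃) ^ e₃ * (X - C a₄) ^ e₄ ≠ 0 :=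
  mul_ne_zero (mul_ne_zero (mul_ne_zero (pow_ne_zero _ (X_sub_C_ne_zero _))
    (pow_ne_zero _ (X_sub_C_ne_zero _))) (pow_ne_zero _ (X_sub_C_ne_zero _)))
    (pow_ne_zero _ (X_sub_C_ne_zero _))

theorem X_pow_sub_C_one_eq_pow [Fact p.Prime] [CharP F p] (ς : ℕ) :
    (X ^ (4 * p ^ ς) - C 1 : F[X]) = (X ^ 4 - C 1) ^ p ^ ς := by
  have := X_pow_sub_C_eq_pow (F := F) (p := p) ς 1
  rwa [one_pow] at this

theorem FourthRoots.dvd [Fact p.Prime] [CharP F p] (ha : FourthRoots a₁ a₂ a₃ a₄)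
    (h₁ : e₁ ≤ p ^ ς) (h₂ : e₂ ≤ p ^ ς) (h₃ : e₃ ≤ p ^ ς) (h₄ : e₄ ≤ p ^ ς) :
    (X - C a₁) ^ e₁ * (X - C a₂) ^ e₂ * (X - C a₃) ^ e₃ * (X - C a₄) ^ e₄ ∣
      X ^ (4 * p ^ ς) - C 1 := by
  rw [X_pow_sub_C_one_eq_pow, ← ha.prod_eq, mul_pow, mul_pow, mul_pow]
  exact mul_dvd_mul (mul_dvd_mul (mul_dvd_mul (pow_dvd_pow _ h₁) (pow_dvd_pow _ h₂))
    (pow_dvd_pow _ h₃)) (pow_dvd_pow _ h₄)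

/-- The word `f` is nonzero because `a₄` is a root of it of multiplicity only `k₄ < p ^ ς`. Hence it
is enough that `a₄` differs from the other roots, and `k₁, k₂, k₃` may be arbitrarily large. -/
theorem FourthRoots.minDist_le [Fact p.Prime] [CharP F p] (ha : FourthRoots a₁ a₂ a₃ a₄)
    {k₁ k₂ k₃ k₄ w : ℕ} {f : F[X]} (h₁ : e₁ ≤ k₁) (h₂ : e₂ ≤ k₂) (h₃ : e₃ ≤ k₃) (h₄ : e₄ ≤ k₄)
    (hk : k₄ < p ^ ς)
    (hf : f = (X - C a₁) ^ k₁ * (X - C a₂) ^ k₂ * (X - C a₃) ^ k₃ * (X - C a₄) ^ k₄)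
    (hw : f.support.card ≤ w) :
    minDist (code (4 * p ^ ς) 1
      ((X - C a₁) ^ e₁ * (X - C a₂) ^ e₂ * (X - C a₃) ^ e₃ * (X - C a₄) ^ e₄)) ≤ w := by
  have hco : ∀ {b : F} (k : ℕ), a₄ ≠ b → IsCoprime (X - C a₄) ((X - C b) ^ k) := fun k h =>
    (isCoprime_X_sub_C_of_isUnit_sub (isUnit_iff_ne_zero.2 (sub_ne_zero.2 h))).pow_right
  refine minDist_le_of_isCoprime (q := p ^ ς) (k := k₄) (B := X - C a₄) (by omega) ?_
    (((hco k₁ ha.ne₁).mul_right (hco k₂ ha.ne₂)).mul_right (hco k₃ ha.ne₃))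
    (by rw [natDegree_X_sub_C]; norm_num) hk ?_ (hf ▸ hw)
  · rw [X_pow_sub_C_one_eq_pow, ← ha.prod_eq]
    exact pow_dvd_pow_of_dvd (dvd_mul_left _ _) _
  · exact mul_dvd_mul (mul_dvd_mul (mul_dvd_mul (pow_dvd_pow _ h₁) (pow_dvd_pow _ h₂))
      (pow_dvd_pow _ h₃)) (pow_dvd_pow _ h₄)

/-- For decreasing exponents, an AMDS code has one of three shapes. -/
theorem FourthRoots.eq_of_isAMDS [Fact p.Prime] [CharP F p] (hq : 3 ≤ p ^ ς)
    (ha : FourthRoots a₁ a₂ a₃ a₄) (h₁ : e₁ ≤ p ^ ς) (h₂ : e₂ ≤ e₁) (h₃ : e₃ ≤ e₂) (h₄ : e₄ ≤ e₃)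
    (h : IsAMDS (code (4 * p ^ ς) 1
      ((X - C a₁) ^ e₁ * (X - C a₂) ^ e₂ * (X - C a₃) ^ e₃ * (X - C a₄) ^ e₄))) :
    (e₁ = 2 ∧ e₂ = 0 ∧ e₃ = 0 ∧ e₄ = 0) ∨ (e₁ = 1 ∧ e₂ = 1 ∧ e₃ = 0 ∧ e₄ = 0) ∨
      (e₁ = 2 ∧ e₂ = 1 ∧ e₃ = 0 ∧ e₄ = 0) := by
  have hdeg := natDegree_linear_factors a₁ a₂ a₃ a₄ e₁ e₂ e₃ e₄
  have hg0 := linear_factors_ne_zero a₁ a₂ a₃ a₄ e₁ e₂ e₃ e₄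
  have hg := ha.dvd (e₁ := e₁) (e₂ := e₂) (e₃ := e₃) (e₄ := e₄) h₁ (by omega) (by omega) (by omega)
  by_cases hzero : e₄ = p ^ ς
  · exact absurd h (not_isAMDS_of_natDegree_eq (by omega) hg (by omega))
  have hfrob : ∀ (P : F[X]) {w : ℕ}, P.natDegree ≤ w → (P ^ p ^ ς).support.card ≤ w + 1 :=
    fun P w hP => (card_support_pow_char_pow_le p ς P).trans (card_support_le_of_natDegree_le hP)
  have hd₁ : (X - C a₁ : F[X]).natDegree ≤ 1 := (natDegree_X_sub_C a₁).le
  have hd₂ : ((X - C a₁) * (X - C a₂) : F[X]).natDegree ≤ 2 := by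
    simpa using (natDegree_linear_factors a₁ a₂ a₃ a₄ 1 1 0 0).le
  have hd₃ : ((X - C a₁) * (X - C a₂) * (X - C a₃) : F[X]).natDegree ≤ 3 := by
    simpa using (natDegree_linear_factors a₁ a₂ a₃ a₄ 1 1 1 0).le
  rw [isAMDS_iff hg hg0 (by omega), hdeg] at h
  have hpos := h.le.trans' (one_le_minDist hg hg0 (by omega))
  have htwo : 1 ≤ e₁ → 2 ≤ e₁ + e₂ + e₃ + e₄ := fun h1 =>
    h.le.trans' <| two_le_minDist one_ne_zero hg (by omega) (by omega)
  -- In this bound and the next three, the first `s = 0, 1, 2, 3` linear factors are raised to the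
  -- power `p ^ ς`, costing a factor `s + 1` in the number of terms, and the remaining exponents are
  -- covered at the cost of `e + 1` terms, `e` being the largest of them.
  have hb₁ : e₁ < p ^ ς → e₁ + e₂ + e₃ + e₄ ≤ e₁ + 1 := fun hlt => h.ge.trans <|
    ha.minDist_le (f := (X ^ 4 - C 1) ^ e₁) (k₁ := e₁) (k₂ := e₁) (k₃ := e₁) (k₄ := e₁)
      (by omega) (by omega) (by omega) (by omega) hlt (by simp only [← ha.prod_eq, mul_pow])
      (card_support_X_pow_sub_C_pow_le 4 1 e₁)
  have hb₂ : e₂ < p ^ ς → e₁ + e₂ + e₃ + e₄ ≤ (1 + 1) * (e₂ + 1) := fun hlt => h.ge.trans <|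
    ha.minDist_le (f := (X - C a₁) ^ p ^ ς * (X ^ 4 - C 1) ^ e₂) (k₁ := p ^ ς + e₂) (k₂ := e₂)
      (k₃ := e₂) (k₄ := e₂) (by omega) (by omega) (by omega) (by omega) hlt
      (by simp only [← ha.prod_eq, mul_pow, pow_add]; ring)
      (card_support_mul_le_of_le (hfrob _ hd₁) (card_support_X_pow_sub_C_pow_le 4 1 e₂))
  have hb₃ : e₃ < p ^ ς → e₁ + e₂ + e₃ + e₄ ≤ (2 + 1) * (e₃ + 1) := fun hlt => h.ge.trans <|
    ha.minDist_le (f := ((X - C a₁) * (X - C a₂)) ^ p ^ ς * (X ^ 4 - C 1) ^ e₃)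
      (k₁ := p ^ ς + e₃) (k₂ := p ^ ς + e₃) (k₃ := e₃) (k₄ := e₃)
      (by omega) (by omega) (by omega) (by omega) hlt (by simp only [← ha.prod_eq, mul_pow, pow_add]; ring)
      (card_support_mul_le_of_le (hfrob _ hd₂) (card_support_X_pow_sub_C_pow_le 4 1 e₃))
  have hb₄ : e₁ + e₂ + e₃ + e₄ ≤ (3 + 1) * (e₄ + 1) := h.ge.trans <|
    ha.minDist_le (f := ((X - C a₁) * (X - C a₂) * (X - C a₃)) ^ p ^ ς * (X - C a₄) ^ e₄)
      (k₁ := p ^ ς) (k₂ := p ^ ς) (k₃ := p ^ ς) (k₄ := e₄)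
      (by omega) (by omega) (by omega) le_rfl (by omega) (by simp only [mul_pow])
      (card_support_mul_le_of_le (hfrob _ hd₃)
        (by simpa using card_support_X_pow_sub_C_pow_le 1 a₄ e₄))
  -- Here the degree `4 p ^ ς - 1` respects all the bounds, but the code has dimension one and
  -- distance `4 p ^ ς`.
  have hmds : ¬ (e₁ = p ^ ς ∧ e₂ = p ^ ς ∧ e₃ = p ^ ς ∧ e₄ + 1 = p ^ ς) := by
    rintro ⟨r₁, r₂, r₃, r₄⟩
    have := minDist_eq_length_of_mul_eq (n := 4 * p ^ ς) (β := (1 : F)) (a := a₄)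
      (g := (X - C a₁) ^ e₁ * (X - C a₂) ^ e₂ * (X - C a₃) ^ e₃ * (X - C a₄) ^ e₄)
      (by omega) one_ne_zero (by
        rw [X_pow_sub_C_one_eq_pow, ← ha.prod_eq, mul_pow, mul_pow, mul_pow, r₁, r₂, r₃, ← r₄]
        ring)
    omega
  have hb₀ : e₂ = 0 → e₁ ≤ 2 := by
    intro h0
    have := hb₂ (by omega)
    omega
  clear h hg0 hg hdeg hfrob hd₁ hd₂ hd₃
  omega

end PrimePower

/-! ### Four linear factors with the roots `1, -1, δ, -δ` -/

section LinearFactors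

variable {F : Type*} [Field F] {p ς : ℕ}

theorem two_ne_zero_of_charP [Fact p.Prime] [CharP F p] (hp2 : p ≠ 2) : (2 : F) ≠ 0 := by
  intro h
  have h1 : p ∣ 2 := (CharP.cast_eq_zero_iff F p 2).1 (by exact_mod_cast h)
  exact hp2 ((Nat.prime_dvd_prime_iff_eq (Fact.out : p.Prime) Nat.prime_two).1 h1)

variable {δ : F}

theorem linear_factors_prod (hδ : δ ^ 2 = -1) :
    ((X - C 1) * (X - C (-1)) * (X - C δ) * (X - C (-δ)) : F[X]) = X ^ 4 - C 1 := by
  have h : (C δ ^ 2 : F[X]) = -1 := by rw [← C_pow, hδ, C_neg, C_1]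
  simp only [C_neg, C_1]
  linear_combination (1 - X ^ 2) * h

theorem neg_ne_one_of_sq (h2 : (2 : F) ≠ 0) (hδ : δ ^ 2 = -1) : -δ ≠ 1 := by
  intro h
  apply h2
  linear_combination (δ - 1) * h + hδ

theorem neg_ne_neg_one_of_sq (h2 : (2 : F) ≠ 0) (hδ : δ ^ 2 = -1) : -δ ≠ -1 := by
  intro h
  apply h2
  linear_combination (1 + δ) * h + hδ

theorem neg_ne_self_of_sq (h2 : (2 : F) ≠ 0) (hδ : δ ^ 2 = -1) : -δ ≠ δ := by
  intro h
  apply h2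
  linear_combination δ * h + 2 * hδ

theorem fourthRoots_one_neg_one (h2 : (2 : F) ≠ 0) (hδ : δ ^ 2 = -1) :
    FourthRoots 1 (-1) δ (-δ) :=
  ⟨linear_factors_prod hδ, neg_ne_one_of_sq h2 hδ, neg_ne_neg_one_of_sq h2 hδ,
    neg_ne_self_of_sq h2 hδ⟩

theorem fourthRoots_one_delta (h2 : (2 : F) ≠ 0) (hδ : δ ^ 2 = -1) :
    FourthRoots 1 δ (-1) (-δ) :=
  ⟨by rw [← linear_factors_prod hδ]; ring, neg_ne_one_of_sq h2 hδ, neg_ne_self_of_sq h2 hδ,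
    neg_ne_neg_one_of_sq h2 hδ⟩

theorem linearCode_eq (δ : F) (ι j μ ℓ : ℕ) : linearCode p ς δ ι j μ ℓ = code (4 * p ^ ς) 1
    ((X - C 1) ^ ι * (X - C (-1)) ^ j * (X - C δ) ^ μ * (X - C (-δ)) ^ ℓ) := by
  simp [linearCode]

/-- This order of the factors makes the exponents decreasing when `j ≤ μ`, as
`FourthRoots.eq_of_isAMDS` requires. -/
theorem linearCode_eq' (δ : F) (ι j μ ℓ : ℕ) : linearCode p ς δ ι j μ ℓ = code (4 * p ^ ς) 1
    ((X - C 1) ^ ι * (X - C δ) ^ μ * (X - C (-1)) ^ j * (X - C (-δ)) ^ ℓ) := by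
  rw [linearCode_eq]
  congr 1
  ring

variable [Fact p.Prime] [CharP F p]

theorem isAMDS_linearCode_iff (h2 : (2 : F) ≠ 0) (hδ : δ ^ 2 = -1) {ι j μ ℓ : ℕ}
    (h₁ : ι ≤ p ^ ς) (h₂ : j ≤ p ^ ς) (h₃ : μ ≤ p ^ ς) (h₄ : ℓ ≤ p ^ ς) :
    IsAMDS (linearCode p ς δ ι j μ ℓ) ↔ minDist (linearCode p ς δ ι j μ ℓ) = ι + j + μ + ℓ := by
  have hdeg := natDegree_linear_factors 1 (-1) δ (-δ) ι j μ ℓ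
  rw [linearCode_eq, isAMDS_iff ((fourthRoots_one_neg_one h2 hδ).dvd h₁ h₂ h₃ h₄)
    (linear_factors_ne_zero _ _ _ _ _ _ _ _) (by omega), hdeg]

theorem two_le_minDist_linearCode (h2 : (2 : F) ≠ 0) (hδ : δ ^ 2 = -1) {ι j μ ℓ : ℕ}
    (h₁ : ι ≤ p ^ ς) (h₂ : j ≤ p ^ ς) (h₃ : μ ≤ p ^ ς) (h₄ : ℓ ≤ p ^ ς)
    (hpos : 1 ≤ ι + j + μ + ℓ) (hlt : ι + j + μ + ℓ < 4 * p ^ ς) :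
    2 ≤ minDist (linearCode p ς δ ι j μ ℓ) := by
  have hdeg := natDegree_linear_factors 1 (-1) δ (-δ) ι j μ ℓ
  rw [linearCode_eq]
  exact two_le_minDist one_ne_zero ((fourthRoots_one_neg_one h2 hδ).dvd h₁ h₂ h₃ h₄)
    (by omega) (by omega)

/-- The codes divided by `X ^ (2 p ^ ς) - 1` contain a word of weight two. -/
theorem minDist_linearCode_le_two (h2 : (2 : F) ≠ 0) (hδ : δ ^ 2 = -1) {ι j : ℕ}
    (h₁ : ι ≤ p ^ ς) (h₂ : j ≤ p ^ ς) : minDist (linearCode p ς δ ι j 0 0) ≤ 2 := by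
  have hq : 0 < p ^ ς := pow_pos (Fact.out : p.Prime).pos _
  rw [linearCode_eq]
  refine (fourthRoots_one_neg_one h2 hδ).minDist_le (f := (X ^ 2 - C 1) ^ p ^ ς)
    (k₁ := p ^ ς) (k₂ := p ^ ς) (k₃ := 0) (k₄ := 0) h₁ h₂ le_rfl le_rfl hq ?_
    ((card_support_pow_char_pow_le p ς _).trans
      (by simpa using card_support_X_pow_sub_C_pow_le 2 (1 : F) 1))
  rw [pow_zero, pow_zero, mul_one, mul_one, ← mul_pow]
  congr 1
  simp only [C_neg, C_1]
  ring

/-- The codes divided by `(X ^ 4 - 1) ^ (p ^ k)` with `k < ς` contain a word of weight two. -/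
theorem minDist_linearCode_le_two_of_lt (h2 : (2 : F) ≠ 0) (hδ : δ ^ 2 = -1) {ι j μ ℓ k : ℕ}
    (hk : k < ς) (h₁ : ι ≤ p ^ k) (h₂ : j ≤ p ^ k) (h₃ : μ ≤ p ^ k) (h₄ : ℓ ≤ p ^ k) :
    minDist (linearCode p ς δ ι j μ ℓ) ≤ 2 := by
  rw [linearCode_eq]
  refine (fourthRoots_one_neg_one h2 hδ).minDist_le (f := (X ^ 4 - C 1) ^ p ^ k) h₁ h₂ h₃ h₄
    (Nat.pow_lt_pow_right (Fact.out : p.Prime).one_lt hk) ?_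
    ((card_support_pow_char_pow_le p k _).trans
      (by simpa using card_support_X_pow_sub_C_pow_le 4 (1 : F) 1))
  rw [← linear_factors_prod hδ]
  simp only [mul_pow]

theorem minDist_linearCode_two_zero (h2 : (2 : F) ≠ 0) (hq : 3 ≤ p ^ ς) (hδ : δ ^ 2 = -1) :
    minDist (linearCode p ς δ 2 0 0 0) = 2 :=
  le_antisymm (minDist_linearCode_le_two h2 hδ (by omega) (by omega))
    (two_le_minDist_linearCode h2 hδ (by omega) (by omega) (by omega) (by omega) (by omega)
      (by omega))

theorem minDist_linearCode_one_one (h2 : (2 : F) ≠ 0) (hq : 3 ≤ p ^ ς) (hδ : δ ^ 2 = -1) :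
    minDist (linearCode p ς δ 1 1 0 0) = 2 :=
  le_antisymm (minDist_linearCode_le_two h2 hδ (by omega) (by omega))
    (two_le_minDist_linearCode h2 hδ (by omega) (by omega) (by omega) (by omega) (by omega)
      (by omega))

theorem minDist_linearCode_one_zero_one (h2 : (2 : F) ≠ 0) (hq : 3 ≤ p ^ ς) (hς : 1 ≤ ς)
    (hδ : δ ^ 2 = -1) : minDist (linearCode p ς δ 1 0 1 0) = 2 :=
  le_antisymm (minDist_linearCode_le_two_of_lt h2 hδ (k := 0) hς (by simp) (by simp) (by simp)
      (by simp))
    (two_le_minDist_linearCode h2 hδ (by omega) (by omega) (by omega) (by omega) (by omega)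
      (by omega))

theorem four_dvd_of_pow_eq_one (h2 : (2 : F) ≠ 0) (hδ : δ ^ 2 = -1) {k : ℕ} (hk : δ ^ k = 1) :
    4 ∣ k := by
  have h4 : orderOf δ = 2 ^ (1 + 1) := by
    refine orderOf_eq_prime_pow ?_ ?_
    · rw [pow_one, hδ]
      intro h
      exact h2 (by linear_combination -h)
    · norm_num
      rw [show δ ^ 4 = (δ ^ 2) ^ 2 by ring, hδ]
      norm_num
  simpa [h4] using orderOf_dvd_of_pow_eq_one hk

/-- At most 3, because of `((X - 1) (X - δ)) ^ p`. A two-term codeword with exponents `i < k < 4p`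
has a double root at `1`, which gives `p ∣ k - i`, and a root at `δ`, of order 4, which gives `4 ∣ k
- i`; together these contradict `k - i < 4p`. -/
theorem minDist_linearCode_two_zero_one (hp2 : p ≠ 2) (hδ : δ ^ 2 = -1) :
    minDist (linearCode p 1 δ 2 0 1 0) = 3 := by
  have hp : p.Prime := Fact.out
  have h2 : (2 : F) ≠ 0 := two_ne_zero_of_charP hp2
  have hq := three_le_pow hp hp2 le_rfl
  have hlow := two_le_minDist_linearCode (ς := 1) (ι := 2) (j := 0) (μ := 1) (ℓ := 0) h2 hδ
    (by omega) (by omega) (by omega) (by omega) (by omega) (by omega)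
  have hup : minDist (linearCode p 1 δ 2 0 1 0) ≤ 3 := by
    rw [linearCode_eq']
    refine (fourthRoots_one_delta h2 hδ).minDist_le (f := ((X - C 1) * (X - C δ)) ^ p ^ 1)
      (k₁ := p ^ 1) (k₂ := p ^ 1) (k₃ := 0) (k₄ := 0) (by omega) (by omega) le_rfl le_rfl
      (by omega) (by simp [mul_pow]) ((card_support_pow_char_pow_le p 1 _).trans
        (card_support_le_of_natDegree_le ?_))
    simpa using (natDegree_linear_factors 1 δ (-1) (-δ) 1 1 0 0).le
  by_contra hne
  have hdeg := natDegree_linear_factors 1 (-1) δ (-δ) 2 0 1 0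
  obtain ⟨c, h0, hdvd, hc⟩ := exists_minDist_eq (n := 4 * p ^ 1)
    ((fourthRoots_one_neg_one h2 hδ).dvd (e₁ := 2) (e₂ := 0) (e₃ := 1) (e₄ := 0) (by omega)
      (by omega) (by omega) (by omega)) (linear_factors_ne_zero _ _ _ _ _ _ _ _) (by omega)
  rw [← linearCode_eq, show minDist (linearCode p 1 δ 2 0 1 0) = 2 by omega,
    card_support_eq_two] at hc
  obtain ⟨i, k, hik, x, y, hx, hy, hc⟩ := hc
  have hk : k < 4 * p := by
    by_contra hk
    have h := coeff_wordPoly_of_le c (k := k) (by rw [pow_one]; omega)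
    rw [hc] at h
    simp [coeff_X_pow, hik.ne', hy] at h
  obtain ⟨h, hh⟩ := hdvd
  rw [hc] at hh
  have e1 : x + y = 0 := by
    have := congrArg (eval 1) hh
    simpa using this
  have e2 : x * i + y * k = 0 := by
    have := congrArg (fun P => eval 1 (derivative P)) hh
    simpa [derivative_mul, derivative_pow] using this
  have e3 : x * δ ^ i + y * δ ^ k = 0 := by
    have := congrArg (eval δ) hh
    simpa using this
  have hδ0 : δ ≠ 0 := by rintro rfl; simp at hδ
  obtain ⟨t, rfl⟩ := Nat.exists_eq_add_of_lt hik
  -- The exponent gap is `t + 1`. Substituting `x = -y` into the vanishing derivative at `1` leaves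
  -- `y (t + 1) = 0`.
  have d1 : p ∣ t + 1 := by
    rw [← CharP.cast_eq_zero_iff F p]
    apply mul_left_cancel₀ hy
    push_cast at e2 ⊢
    linear_combination e2 - i * e1
  have d2 : 4 ∣ t + 1 := by
    refine four_dvd_of_pow_eq_one h2 hδ (mul_left_cancel₀ (mul_ne_zero hy (pow_ne_zero i hδ0)) ?_)
    rw [add_assoc, pow_add] at e3
    linear_combination e3 - δ ^ i * e1
  have hco : Nat.Coprime 4 p :=
    Nat.Coprime.pow_left 2 ((Nat.coprime_primes Nat.prime_two hp).2 hp2.symm)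
  have := Nat.le_of_dvd (by omega) (hco.mul_dvd_of_dvd_of_dvd d2 d1)
  omega

theorem isAMDS_linearCode_iff_of_le_mu (hp2 : p ≠ 2) (hς : 1 ≤ ς) (hδ : δ ^ 2 = -1) {ι j μ ℓ : ℕ}
    (h₁ : ℓ ≤ j) (h₂ : j ≤ μ) (h₃ : μ ≤ ι) (h₄ : ι ≤ p ^ ς) :
    IsAMDS (linearCode p ς δ ι j μ ℓ) ↔
      (ι = 2 ∧ j = 0 ∧ μ = 0 ∧ ℓ = 0) ∨ (ι = 1 ∧ j = 0 ∧ μ = 1 ∧ ℓ = 0) ∨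
        (ς = 1 ∧ ι = 2 ∧ j = 0 ∧ μ = 1 ∧ ℓ = 0) := by
  have hp : p.Prime := Fact.out
  have h2 : (2 : F) ≠ 0 := two_ne_zero_of_charP hp2
  have hq := three_le_pow hp hp2 hς
  have hiff := isAMDS_linearCode_iff h2 hδ h₄ (by omega : j ≤ p ^ ς) (by omega : μ ≤ p ^ ς)
    (by omega : ℓ ≤ p ^ ς)
  constructor
  · intro h
    have hd := hiff.1 h
    rw [linearCode_eq'] at h
    rcases (fourthRoots_one_delta h2 hδ).eq_of_isAMDS hq h₄ h₃ h₂ h₁ h with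
      ⟨rfl, rfl, rfl, rfl⟩ | ⟨rfl, rfl, rfl, rfl⟩ | ⟨rfl, rfl, rfl, rfl⟩
    · simp
    · simp
    · by_cases h1 : ς = 1
      · simp [h1]
      -- For `ς ≥ 2` the two-term word `(X ^ 4 - 1) ^ p` is a nonzero codeword, so the distance 2 is
      -- below the degree 3.
      · have hpp : 2 ≤ p ^ 1 := by rw [pow_one]; exact hp.two_le
        have := minDist_linearCode_le_two_of_lt (ς := ς) (ι := 2) (j := 0) (μ := 1) (ℓ := 0)
          h2 hδ (k := 1) (by omega) hpp (by omega) (by omega) (by omega)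
        omega
  · rw [hiff]
    rintro (⟨rfl, rfl, rfl, rfl⟩ | ⟨rfl, rfl, rfl, rfl⟩ | ⟨rfl, rfl, rfl, rfl, rfl⟩)
    · exact minDist_linearCode_two_zero h2 hq hδ
    · exact minDist_linearCode_one_zero_one h2 hq hς hδ
    · exact minDist_linearCode_two_zero_one hp2 hδ

theorem isAMDS_linearCode_iff_of_le_j (hp2 : p ≠ 2) (hς : 1 ≤ ς) (hδ : δ ^ 2 = -1) {ι j μ ℓ : ℕ}
    (h₁ : ℓ ≤ μ) (h₂ : μ ≤ j) (h₃ : j ≤ ι) (h₄ : ι ≤ p ^ ς) :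
    IsAMDS (linearCode p ς δ ι j μ ℓ) ↔
      (ι = 2 ∧ j = 0 ∧ μ = 0 ∧ ℓ = 0) ∨ (ι = 1 ∧ j = 1 ∧ μ = 0 ∧ ℓ = 0) := by
  have hp : p.Prime := Fact.out
  have h2 : (2 : F) ≠ 0 := two_ne_zero_of_charP hp2
  have hq := three_le_pow hp hp2 hς
  have hiff := isAMDS_linearCode_iff h2 hδ h₄ (by omega : j ≤ p ^ ς) (by omega : μ ≤ p ^ ς)
    (by omega : ℓ ≤ p ^ ς)
  constructor
  · intro h
    have hd := hiff.1 h
    rw [linearCode_eq] at h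
    rcases (fourthRoots_one_neg_one h2 hδ).eq_of_isAMDS hq h₄ h₃ h₂ h₁ h with
      ⟨rfl, rfl, rfl, rfl⟩ | ⟨rfl, rfl, rfl, rfl⟩ | ⟨rfl, rfl, rfl, rfl⟩
    · simp
    · simp
    -- The word `X ^ (2 p ^ ς) - 1` brings the distance to 2, below the degree 3.
    · have := minDist_linearCode_le_two (ς := ς) (ι := 2) (j := 1) h2 hδ (by omega) (by omega)
      omega
  · rw [hiff]
    rintro (⟨rfl, rfl, rfl, rfl⟩ | ⟨rfl, rfl, rfl, rfl⟩)
    · exact minDist_linearCode_two_zero h2 hq hδ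
    · exact minDist_linearCode_one_one h2 hq hδ

end LinearFactors

/-! ### Two linear factors and a quadratic one -/

section MixedFactors

variable {F : Type*} [Field F] {p ς : ℕ} {ι j μ : ℕ}

theorem natDegree_X_sq_add_one : (X ^ 2 + 1 : F[X]).natDegree = 2 := by
  simpa using natDegree_X_pow_add_C (R := F) (n := 2) (r := 1)

theorem mixed_factors_ne_zero (ι j μ : ℕ) :
    ((X - 1) ^ ι * (X + 1) ^ j * (X ^ 2 + 1) ^ μ : F[X]) ≠ 0 := by
  refine mul_ne_zero (mul_ne_zero (pow_ne_zero _ ?_) (pow_ne_zero _ ?_)) (pow_ne_zero _ ?_)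
  · simpa using X_sub_C_ne_zero (1 : F)
  · simpa using X_add_C_ne_zero (1 : F)
  · intro h
    have := natDegree_X_sq_add_one (F := F)
    simp [h] at this

theorem natDegree_mixed_factors (ι j μ : ℕ) :
    ((X - 1) ^ ι * (X + 1) ^ j * (X ^ 2 + 1) ^ μ : F[X]).natDegree = ι + j + 2 * μ := by
  have h := mixed_factors_ne_zero (F := F) ι j μ
  have h1 : (X - 1 : F[X]).natDegree = 1 := by simpa using natDegree_X_sub_C (1 : F)
  have h2 : (X + 1 : F[X]).natDegree = 1 := by simpa using natDegree_X_add_C (1 : F)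
  rw [natDegree_mul (left_ne_zero_of_mul h) (right_ne_zero_of_mul h),
    natDegree_mul (left_ne_zero_of_mul (left_ne_zero_of_mul h))
      (right_ne_zero_of_mul (left_ne_zero_of_mul h)), natDegree_pow, natDegree_pow, natDegree_pow,
    h1, h2, natDegree_X_sq_add_one]
  ring

theorem mixed_factors_prod :
    ((X - 1) * (X + 1) * (X ^ 2 + 1) : F[X]) = X ^ 4 - C 1 := by
  rw [C_1]; ring

theorem isCoprime_X_sq_add_one (h2 : (2 : F) ≠ 0) :
    IsCoprime (X ^ 2 + 1 : F[X]) ((X - 1) * (X + 1)) := by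
  have h : (C 2⁻¹ * 2 : F[X]) = 1 := by
    rw [← C_ofNat, ← C_mul, inv_mul_cancel₀ h2, C_1]
  exact ⟨C 2⁻¹, -C 2⁻¹, by linear_combination h⟩

theorem isCoprime_X_add_one (h2 : (2 : F) ≠ 0) :
    IsCoprime (X + 1 : F[X]) ((X - 1) * (X ^ 2 + 1)) := by
  have h := isCoprime_X_sq_add_one h2
  have h1 : IsCoprime (X - C (-1) : F[X]) (X - C 1) := by
    refine isCoprime_X_sub_C_of_isUnit_sub (isUnit_iff_ne_zero.2 fun h0 => h2 ?_)
    linear_combination -h0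
  simp only [C_neg, C_1, sub_neg_eq_add] at h1
  exact h1.mul_right (h.of_mul_right_right).symm

variable [Fact p.Prime] [CharP F p]

theorem mixed_factors_dvd (h₁ : ι ≤ p ^ ς) (h₂ : j ≤ p ^ ς) (h₃ : μ ≤ p ^ ς) :
    ((X - 1) ^ ι * (X + 1) ^ j * (X ^ 2 + 1) ^ μ : F[X]) ∣ X ^ (4 * p ^ ς) - C 1 := by
  rw [X_pow_sub_C_one_eq_pow, ← mixed_factors_prod, mul_pow, mul_pow]
  exact mul_dvd_mul (mul_dvd_mul (pow_dvd_pow _ h₁) (pow_dvd_pow _ h₂)) (pow_dvd_pow _ h₃)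

theorem isAMDS_mixedCode_iff (h₁ : ι ≤ p ^ ς) (h₂ : j ≤ p ^ ς) (h₃ : μ ≤ p ^ ς) :
    IsAMDS (mixedCode F p ς ι j μ) ↔ minDist (mixedCode F p ς ι j μ) = ι + j + 2 * μ := by
  have hdeg := natDegree_mixed_factors (F := F) ι j μ
  rw [mixedCode, isAMDS_iff (mixed_factors_dvd h₁ h₂ h₃) (mixed_factors_ne_zero _ _ _) (by omega),
    hdeg]

theorem not_isAMDS_mixedCode_zero :
    ¬ IsAMDS (mixedCode F p ς (p ^ ς) (p ^ ς) (p ^ ς)) := by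
  have hq : 0 < p ^ ς := pow_pos (Fact.out : p.Prime).pos _
  have hdeg := natDegree_mixed_factors (F := F) (p ^ ς) (p ^ ς) (p ^ ς)
  exact not_isAMDS_of_natDegree_eq (by omega) (mixed_factors_dvd le_rfl le_rfl le_rfl) (by omega)

theorem two_le_minDist_mixedCode (h₁ : ι ≤ p ^ ς) (h₂ : j ≤ p ^ ς) (h₃ : μ ≤ p ^ ς)
    (hpos : 1 ≤ ι + j + 2 * μ) (hlt : ι + j + 2 * μ < 4 * p ^ ς) :
    2 ≤ minDist (mixedCode F p ς ι j μ) := by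
  have hdeg := natDegree_mixed_factors (F := F) ι j μ
  exact two_le_minDist one_ne_zero (mixed_factors_dvd h₁ h₂ h₃) (by omega) (by omega)

theorem one_le_minDist_mixedCode (h₁ : ι ≤ p ^ ς) (h₂ : j ≤ p ^ ς) (h₃ : μ ≤ p ^ ς)
    (hlt : ι + j + 2 * μ < 4 * p ^ ς) : 1 ≤ minDist (mixedCode F p ς ι j μ) := by
  have hdeg := natDegree_mixed_factors (F := F) ι j μ
  exact one_le_minDist (mixed_factors_dvd h₁ h₂ h₃) (mixed_factors_ne_zero _ _ _) (by omega)

theorem minDist_mixedCode_le_of_lt (h₁ : ι < p ^ ς) (h₂ : j ≤ ι) (h₃ : μ ≤ ι) :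
    minDist (mixedCode F p ς ι j μ) ≤ ι + 1 := by
  have h := minDist_le_of_dvd_pow (ς := ς) (b := (1 : F)) (k := ι)
    (g := (X - 1) ^ ι * (X + 1) ^ j * (X ^ 2 + 1) ^ μ) h₁ (by
      rw [← mixed_factors_prod, mul_pow, mul_pow]
      exact mul_dvd_mul (mul_dvd_mul dvd_rfl (pow_dvd_pow _ h₂)) (pow_dvd_pow _ h₃))
  rwa [one_pow] at h

/-- The bound from `(X ^ 2 - 1) ^ (p ^ ς) (X ^ 2 + 1) ^ μ`. -/
theorem minDist_mixedCode_le_mul_succ (h2 : (2 : F) ≠ 0) (h₁ : ι ≤ p ^ ς) (h₂ : j ≤ p ^ ς)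
    (h₃ : μ < p ^ ς) : minDist (mixedCode F p ς ι j μ) ≤ 2 * (μ + 1) := by
  refine minDist_le_of_isCoprime (q := p ^ ς) (k := μ) (A := ((X - 1) * (X + 1)) ^ p ^ ς)
    (B := X ^ 2 + 1) (by omega) ?_ (isCoprime_X_sq_add_one h2).pow_right
    (by rw [natDegree_X_sq_add_one]; norm_num) h₃ ?_ ?_
  · rw [X_pow_sub_C_one_eq_pow, ← mixed_factors_prod]
    exact pow_dvd_pow_of_dvd (dvd_mul_left _ _) _
  · rw [mul_pow]
    exact mul_dvd_mul (mul_dvd_mul (pow_dvd_pow _ h₁) (pow_dvd_pow _ h₂)) dvd_rfl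
  · refine card_support_mul_le_of_le ((card_support_pow_char_pow_le p ς _).trans ?_) ?_
    · rw [show ((X - 1) * (X + 1) : F[X]) = (X ^ 2 - C 1) ^ 1 by rw [C_1]; ring]
      exact card_support_X_pow_sub_C_pow_le 2 1 1
    · simpa using card_support_X_pow_add_C_pow_le 2 (1 : F) μ

/-- The bound from `(X - 1) ^ (p ^ ς) (X ^ 4 - 1) ^ μ`. -/
theorem minDist_mixedCode_le_of_le (h2 : (2 : F) ≠ 0) (h₁ : ι ≤ p ^ ς) (h₂ : j ≤ μ)
    (h₃ : μ < p ^ ς) : minDist (mixedCode F p ς ι j μ) ≤ 2 * (μ + 1) := by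
  have hf : ((X - 1) ^ (p ^ ς + μ) * (X ^ 2 + 1) ^ μ * (X + 1) ^ μ : F[X]) =
      (X - 1) ^ p ^ ς * (X ^ 4 - C 1) ^ μ := by
    rw [← mixed_factors_prod, mul_pow, mul_pow]; ring
  refine minDist_le_of_isCoprime (q := p ^ ς) (k := μ)
    (A := (X - 1) ^ (p ^ ς + μ) * (X ^ 2 + 1) ^ μ)
    (B := X + 1) (by omega) ?_ ?_
    (by rw [show (X + 1 : F[X]) = X + C 1 by simp, natDegree_X_add_C]; norm_num) h₃ ?_ ?_
  · rw [X_pow_sub_C_one_eq_pow, ← mixed_factors_prod]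
    exact pow_dvd_pow_of_dvd ((dvd_mul_left _ _).mul_right _) _
  · have h := isCoprime_X_add_one h2
    exact (h.of_mul_right_left.pow_right).mul_right h.of_mul_right_right.pow_right
  · rw [mul_right_comm]
    exact mul_dvd_mul (mul_dvd_mul (pow_dvd_pow _ (by omega)) dvd_rfl) (pow_dvd_pow _ h₂)
  · rw [hf]
    refine card_support_mul_le_of_le ((card_support_pow_char_pow_le p ς _).trans ?_)
      (card_support_X_pow_sub_C_pow_le 4 1 μ)
    simpa using card_support_X_pow_sub_C_pow_le 1 (1 : F) 1

/-- The bound from `((X - 1) (X ^ 2 + 1)) ^ (p ^ ς) (X + 1) ^ j`. -/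
theorem minDist_mixedCode_le_four_mul (h2 : (2 : F) ≠ 0) (h₁ : ι ≤ p ^ ς) (h₂ : j < p ^ ς)
    (h₃ : μ ≤ p ^ ς) : minDist (mixedCode F p ς ι j μ) ≤ (3 + 1) * (j + 1) := by
  refine minDist_le_of_isCoprime (q := p ^ ς) (k := j) (A := ((X - 1) * (X ^ 2 + 1)) ^ p ^ ς)
    (B := X + 1) (by omega) ?_ (isCoprime_X_add_one h2).pow_right
    (by rw [show (X + 1 : F[X]) = X + C 1 by simp, natDegree_X_add_C]; norm_num) h₂ ?_ ?_
  · rw [X_pow_sub_C_one_eq_pow, ← mixed_factors_prod]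
    exact pow_dvd_pow_of_dvd ((dvd_mul_left _ _).mul_right _) _
  · rw [mul_pow, mul_right_comm]
    exact mul_dvd_mul (mul_dvd_mul (pow_dvd_pow _ h₁) (pow_dvd_pow _ h₃)) dvd_rfl
  · refine card_support_mul_le_of_le ((card_support_pow_char_pow_le p ς _).trans
      (card_support_le_of_natDegree_le ?_)) (by simpa using card_support_X_pow_add_C_pow_le 1 (1 : F) j)
    simpa using (natDegree_mixed_factors (F := F) 1 0 1).le

theorem minDist_mixedCode_eq_two (h2 : (2 : F) ≠ 0) (hq : 3 ≤ p ^ ς) (h : ι + j = 2) :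
    minDist (mixedCode F p ς ι j 0) = 2 :=
  le_antisymm (minDist_mixedCode_le_mul_succ h2 (by omega) (by omega) (by omega))
    (two_le_minDist_mixedCode (by omega) (by omega) (by omega) (by omega) (by omega))

theorem minDist_mixedCode_eq_length (hj : j + 1 = p ^ ς) :
    minDist (mixedCode F p ς (p ^ ς) j (p ^ ς)) = 4 * p ^ ς := by
  refine minDist_eq_length_of_mul_eq (a := -1) (by omega) one_ne_zero ?_
  rw [X_pow_sub_C_one_eq_pow, ← mixed_factors_prod, mul_pow, mul_pow, C_neg, C_1]
  conv_rhs => rw [← hj, pow_succ (X + 1 : F[X]) j, hj]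
  ring

/-- The bound `ι + j + 2 μ ≤ 2 (μ + 1)` gives `ι + j ≤ 2`; then the bound `ι + 1` excludes `μ = 1`,
and the lower bound 2 excludes degrees 0 and 1. -/
theorem isAMDS_mixedCode_iff_of_le_j (hp2 : p ≠ 2) (hς : 1 ≤ ς) (h₁ : μ ≤ j) (h₂ : j ≤ ι)
    (h₃ : ι ≤ p ^ ς) :
    IsAMDS (mixedCode F p ς ι j μ) ↔ (ι = 1 ∧ j = 1 ∧ μ = 0) ∨ (ι = 2 ∧ j = 0 ∧ μ = 0) := by
  have h2 : (2 : F) ≠ 0 := two_ne_zero_of_charP hp2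
  have hq := three_le_pow (Fact.out : p.Prime) hp2 hς
  have hiff := isAMDS_mixedCode_iff (F := F) h₃ (by omega : j ≤ p ^ ς) (by omega : μ ≤ p ^ ς)
  constructor
  · intro h
    have hd := hiff.1 h
    by_cases hμ : μ = p ^ ς
    · obtain rfl : j = p ^ ς := by omega
      obtain rfl : ι = p ^ ς := by omega
      exact absurd (hμ ▸ h) not_isAMDS_mixedCode_zero
    have hpos := one_le_minDist_mixedCode (F := F) h₃ (by omega : j ≤ p ^ ς)
      (by omega : μ ≤ p ^ ς) (by omega)
    have htwo := two_le_minDist_mixedCode (F := F) h₃ (by omega : j ≤ p ^ ς)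
      (by omega : μ ≤ p ^ ς) (by omega) (by omega)
    have hle := minDist_mixedCode_le_mul_succ h2 h₃ (by omega : j ≤ p ^ ς)
      (by omega : μ < p ^ ς)
    by_cases hι : ι < p ^ ς
    · have := minDist_mixedCode_le_of_lt (F := F) hι h₂ (h₁.trans h₂)
      omega
    · omega
  · rw [hiff]
    rintro (⟨rfl, rfl, rfl⟩ | ⟨rfl, rfl, rfl⟩) <;> exact minDist_mixedCode_eq_two h2 hq rfl

theorem isAMDS_mixedCode_iff_of_le_mu (hp2 : p ≠ 2) (hς : 1 ≤ ς) (h₁ : j ≤ μ) (h₂ : μ ≤ ι)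
    (h₃ : ι ≤ p ^ ς) :
    IsAMDS (mixedCode F p ς ι j μ) ↔ ι = 2 ∧ j = 0 ∧ μ = 0 := by
  have h2 : (2 : F) ≠ 0 := two_ne_zero_of_charP hp2
  have hq := three_le_pow (Fact.out : p.Prime) hp2 hς
  have hiff := isAMDS_mixedCode_iff (F := F) h₃ (by omega : j ≤ p ^ ς) (by omega : μ ≤ p ^ ς)
  constructor
  · intro h
    have hd := hiff.1 h
    by_cases hj : j = p ^ ς
    · obtain rfl : μ = p ^ ς := by omega
      obtain rfl : ι = p ^ ς := by omega
      exact absurd (hj ▸ h) not_isAMDS_mixedCode_zero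
    have hpos := one_le_minDist_mixedCode (F := F) h₃ (by omega : j ≤ p ^ ς)
      (by omega : μ ≤ p ^ ς) (by omega)
    have htwo := two_le_minDist_mixedCode (F := F) h₃ (by omega : j ≤ p ^ ς)
      (by omega : μ ≤ p ^ ς) (by omega) (by omega)
    by_cases hμ : μ < p ^ ς
    · have hle := minDist_mixedCode_le_of_le h2 h₃ h₁ hμ
      by_cases hι : ι < p ^ ς
      · have := minDist_mixedCode_le_of_lt (F := F) hι (h₁.trans h₂) h₂
        omega
      · omega
    · obtain rfl : μ = p ^ ς := by omega
      obtain rfl : ι = p ^ ς := by omega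
      have hle := minDist_mixedCode_le_four_mul h2 h₃ (by omega : j < p ^ ς) h₃
      -- The bound `3 p ^ ς + j ≤ 4 (j + 1)` leaves only `j + 1 = p ^ ς`, where the distance `4 p ^
      -- ς` exceeds the degree by one.
      have hmds : j + 1 = p ^ ς → _ := minDist_mixedCode_eq_length (F := F)
      omega
  · rw [hiff]
    rintro ⟨rfl, rfl, rfl⟩
    exact minDist_mixedCode_eq_two h2 hq rfl

end MixedFactors

/-! ### Quadratic and quartic factors -/

section Binomials

variable {F : Type*} [Field F] {p ς : ℕ}

theorem binomialCode_eq (φ : F) (i j : ℕ) : binomialCode p ς φ i j =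
    code (4 * p ^ ς) ((φ ^ 2) ^ p ^ ς) ((X ^ 2 - C φ) ^ i * (X ^ 2 + C φ) ^ j) := by
  rw [binomialCode, pow_mul]

theorem binomial_mul (φ : F) : ((X ^ 2 - C φ) * (X ^ 2 + C φ) : F[X]) = X ^ 4 - C (φ ^ 2) := by
  rw [C_pow]; ring

theorem isCoprime_binomial {φ : F} (h2 : (2 : F) ≠ 0) (hφ : φ ≠ 0) :
    IsCoprime (X ^ 2 - C φ : F[X]) (X ^ 2 + C φ) := by
  have h : (C (2 * φ)⁻¹ * (2 * C φ) : F[X]) = 1 := by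
    rw [← C_ofNat, ← C_mul, ← C_mul, inv_mul_cancel₀ (mul_ne_zero h2 hφ), C_1]
  exact ⟨-C (2 * φ)⁻¹, C (2 * φ)⁻¹, by linear_combination h⟩

variable {γ c e : F}

theorem natDegree_trinomial (a e : F) : (X ^ 2 + C a * X + C e : F[X]).natDegree = 2 := by
  compute_degree!

theorem trinomial_sub_eq (a e : F) :
    (X ^ 2 - C a * X + C e : F[X]) = X ^ 2 + C (-a) * X + C e := by
  rw [C_neg]; ring

/-- The product is `(x² + e)² - (γc)² x²`, and `(γc)² = 2e` cancels the middle term. -/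
theorem trinomial_mul (hγ : γ ^ 2 = -2) (hc : c ^ 2 = -e) :
    ((X ^ 2 + C (γ * c) * X + C e) * (X ^ 2 - C (γ * c) * X + C e) : F[X]) =
      X ^ 4 - C (-e ^ 2) := by
  have h : (γ * c) ^ 2 = 2 * e := by rw [mul_pow, hγ, hc]; ring
  have h' : (C (γ * c) ^ 2 : F[X]) = 2 * C e := by rw [← C_pow, h, C_mul, C_ofNat]
  rw [C_neg, C_pow]
  linear_combination (-X ^ 2) * h'

/-- The sum of the two is `2x² + 2e` and their difference is `2ax`; subtracting `x / a` times the
difference from the sum leaves `2e`. -/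
theorem isCoprime_trinomial {a : F} (h2 : (2 : F) ≠ 0) (ha : a ≠ 0) (he : e ≠ 0) :
    IsCoprime (X ^ 2 + C a * X + C e : F[X]) (X ^ 2 - C a * X + C e) := by
  have h : (C (2 * e)⁻¹ * (2 * C e) : F[X]) = 1 := by
    rw [← C_ofNat, ← C_mul, ← C_mul, inv_mul_cancel₀ (mul_ne_zero h2 he), C_1]
  have h' : (C a⁻¹ * C a : F[X]) = 1 := by rw [← C_mul, inv_mul_cancel₀ ha, C_1]
  exact ⟨C (2 * e)⁻¹ * (1 - C a⁻¹ * X), C (2 * e)⁻¹ * (1 + C a⁻¹ * X), by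
    linear_combination h - 2 * C (2 * e)⁻¹ * X ^ 2 * h'⟩

/-- For `i < p ^ ς` the distance is positive and at most `i + 1`, which never equals the degree `4
i`; for `i = p ^ ς` the code is zero. -/
theorem not_isAMDS_quarticCode [Fact p.Prime] [CharP F p] (ψ : F) {i : ℕ}
    (hi : i ≤ p ^ ς) : ¬ IsAMDS (quarticCode p ς ψ i) := by
  have hq : 0 < p ^ ς := pow_pos (Fact.out : p.Prime).pos _
  have hQ : (X ^ 4 + C ψ : F[X]) = X ^ 4 - C (-ψ) := by rw [C_neg, sub_neg_eq_add]
  rw [quarticCode, hQ]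
  have hdeg : ((X ^ 4 - C (-ψ)) ^ i : F[X]).natDegree = 4 * i := by
    rw [natDegree_pow, natDegree_X_pow_sub_C, mul_comm]
  have hg : ((X ^ 4 - C (-ψ)) ^ i : F[X]) ∣ X ^ (4 * p ^ ς) - C ((-ψ) ^ p ^ ς) := by
    rw [X_pow_sub_C_eq_pow]
    exact pow_dvd_pow _ hi
  have hg0 : ((X ^ 4 - C (-ψ)) ^ i : F[X]) ≠ 0 := pow_ne_zero _ (X_pow_sub_C_ne_zero (by norm_num) _)
  rcases hi.eq_or_lt with rfl | hlt
  · exact not_isAMDS_of_natDegree_eq (by omega) hg hdeg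
  · rw [isAMDS_iff hg hg0 (by omega), hdeg]
    have h1 := one_le_minDist hg hg0 (by omega)
    have h2 := minDist_le_of_dvd_pow (b := -ψ) hlt (dvd_refl _)
    omega

end Binomials

end Constacyclic

/-! ### The classification over a finite field of odd characteristic -/

open Polynomial Constacyclic in
theorem theorem3p1 (p m ς : ℕ) (hp : p.Prime) (hp2 : p ≠ 2) (hς : 1 ≤ ς)
    (F : Type*) [Field F] [Fintype F] (hF : Fintype.card F = p ^ m) :
    -- (I)
    (∀ δ : F, δ ^ 2 = -1 →
      (∀ ι j μ ℓ : ℕ, ℓ ≤ j → j ≤ μ → μ ≤ ι → ι ≤ p ^ ς →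
        (IsAMDS (linearCode p ς δ ι j μ ℓ) ↔
          (ι = 2 ∧ j = 0 ∧ μ = 0 ∧ ℓ = 0) ∨
          (ι = 1 ∧ j = 0 ∧ μ = 1 ∧ ℓ = 0) ∨
          (ς = 1 ∧ ι = 2 ∧ j = 0 ∧ μ = 1 ∧ ℓ = 0))) ∧
      minDist (linearCode p ς δ 2 0 0 0) = 2 ∧
      minDist (linearCode p ς δ 1 0 1 0) = 2 ∧
      (ς = 1 → minDist (linearCode p ς δ 2 0 1 0) = 3)) ∧
    -- (II)
    (∀ δ : F, δ ^ 2 = -1 →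
      (∀ ι j μ ℓ : ℕ, ℓ ≤ μ → μ ≤ j → j ≤ ι → ι ≤ p ^ ς →
        (IsAMDS (linearCode p ς δ ι j μ ℓ) ↔
          (ι = 2 ∧ j = 0 ∧ μ = 0 ∧ ℓ = 0) ∨
          (ι = 1 ∧ j = 1 ∧ μ = 0 ∧ ℓ = 0))) ∧
      minDist (linearCode p ς δ 2 0 0 0) = 2 ∧
      minDist (linearCode p ς δ 1 1 0 0) = 2) ∧
    -- (III)
    ((∀ ι j μ : ℕ, μ ≤ j → j ≤ ι → ι ≤ p ^ ς →
        (IsAMDS (mixedCode F p ς ι j μ) ↔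
          (ι = 1 ∧ j = 1 ∧ μ = 0) ∨ (ι = 2 ∧ j = 0 ∧ μ = 0))) ∧
      minDist (mixedCode F p ς 1 1 0) = 2 ∧
      minDist (mixedCode F p ς 2 0 0) = 2) ∧
    -- (IV)
    ((∀ ι j μ : ℕ, j ≤ μ → μ ≤ ι → ι ≤ p ^ ς →
        (IsAMDS (mixedCode F p ς ι j μ) ↔ ι = 2 ∧ j = 0 ∧ μ = 0)) ∧
      minDist (mixedCode F p ς 2 0 0) = 2) ∧
    -- (V)
    (∀ φ : F, φ ≠ 0 →
      (∀ ι j : ℕ, ι ≤ p ^ ς → j ≤ p ^ ς →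
        (IsAMDS (binomialCode p ς φ ι j) ↔ (ι = 1 ∧ j = 0) ∨ (ι = 0 ∧ j = 1))) ∧
      minDist (binomialCode p ς φ 1 0) = 2 ∧
      minDist (binomialCode p ς φ 0 1) = 2) ∧
    -- (VI)
    (∀ γ c e : F, γ ^ 2 = -2 → e ≠ 0 → c ^ 2 = -e →
      (∀ ι μ : ℕ, ι ≤ p ^ ς → μ ≤ p ^ ς →
        (IsAMDS (trinomialCode p ς γ c e ι μ) ↔ (ι = 1 ∧ μ = 0) ∨ (ι = 0 ∧ μ = 1))) ∧
      minDist (trinomialCode p ς γ c e 1 0) = 2 ∧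
      minDist (trinomialCode p ς γ c e 0 1) = 2) ∧
    -- (VII)
    (∀ ψ : F, ψ ≠ 0 → Irreducible (X ^ 4 + C ψ : F[X]) →
      ∀ ι : ℕ, ι ≤ p ^ ς → ¬ IsAMDS (quarticCode p ς ψ ι)) := by
  have : Fact p.Prime := ⟨hp⟩
  have : CharP F p := charP_of_card_eq_prime_pow hF
  have h2 : (2 : F) ≠ 0 := two_ne_zero_of_charP hp2
  have hq := three_le_pow hp hp2 hς
  refine ⟨fun δ hδ => ⟨?_, ?_, ?_, ?_⟩, fun δ hδ => ⟨?_, ?_, ?_⟩, ⟨?_, ?_, ?_⟩, ⟨?_, ?_⟩,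
    fun φ hφ => ?_, fun γ c e hγ he hc => ?_, fun ψ _ _ ι hι => not_isAMDS_quarticCode ψ hι⟩
  · exact fun ι j μ ℓ h₁ h₂ h₃ h₄ => isAMDS_linearCode_iff_of_le_mu hp2 hς hδ h₁ h₂ h₃ h₄
  · exact minDist_linearCode_two_zero h2 hq hδ
  · exact minDist_linearCode_one_zero_one h2 hq hς hδ
  · rintro rfl
    exact minDist_linearCode_two_zero_one hp2 hδ
  · exact fun ι j μ ℓ h₁ h₂ h₃ h₄ => isAMDS_linearCode_iff_of_le_j hp2 hς hδ h₁ h₂ h₃ h₄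
  · exact minDist_linearCode_two_zero h2 hq hδ
  · exact minDist_linearCode_one_one h2 hq hδ
  · exact fun ι j μ h₁ h₂ h₃ => isAMDS_mixedCode_iff_of_le_j hp2 hς h₁ h₂ h₃
  · exact minDist_mixedCode_eq_two h2 hq rfl
  · exact minDist_mixedCode_eq_two h2 hq rfl
  · exact fun ι j μ h₁ h₂ h₃ => isAMDS_mixedCode_iff_of_le_mu hp2 hς h₁ h₂ h₃
  · exact minDist_mixedCode_eq_two h2 hq rfl
  · have hA : (X ^ 2 - C φ : F[X]).natDegree = 2 := natDegree_X_pow_sub_C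
    have hB : (X ^ 2 + C φ : F[X]).natDegree = 2 := natDegree_X_pow_add_C
    have hAB := binomial_mul φ
    have hb := pow_ne_zero 2 hφ
    simp only [binomialCode_eq]
    refine ⟨fun ι j hι hj =>
      isAMDS_quadratic_iff hq hb hA hB hAB (isCoprime_binomial h2 hφ) hι hj, ?_, ?_⟩
    · simpa using minDist_quadratic_eq_two hq hb hA hAB
    · simpa using minDist_quadratic_eq_two hq hb hB (by rw [mul_comm, hAB])
  · have hγ0 : γ ≠ 0 := by
      rintro rfl
      exact h2 (by linear_combination hγ)
    have hc0 : c ≠ 0 := by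
      rintro rfl
      exact he (by linear_combination hc)
    have hA := natDegree_trinomial (γ * c) e
    have hB : (X ^ 2 - C (γ * c) * X + C e : F[X]).natDegree = 2 := by
      rw [trinomial_sub_eq, natDegree_trinomial]
    have hAB := trinomial_mul hγ hc
    have hb : -e ^ 2 ≠ 0 := neg_ne_zero.2 (pow_ne_zero 2 he)
    refine ⟨fun ι μ hι hμ => isAMDS_quadratic_iff hq hb hA hB hAB
      (isCoprime_trinomial h2 (mul_ne_zero hγ0 hc0) he) hι hμ, ?_, ?_⟩
    · rw [trinomialCode, pow_one, pow_zero, mul_one]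
      exact minDist_quadratic_eq_two hq hb hA hAB
    · rw [trinomialCode, pow_one, pow_zero, one_mul]
      exact minDist_quadratic_eq_two hq hb hB (by rw [mul_comm, hAB])
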